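/- Let $\mathcal R$ be the set of rooted (non-plane) trees up to isomorphism and $\mathcal F$ the set of rooted plane trees. Write $|t|$ for the number of nodes of $t$, and $t=B_+(t_1,\dots,t_k)$ for the tree whose root carries the subtrees $t_1,\dots,t_k$. Let $t!=|t|\prod_i t_i!$ be the tree factorial, let $\alpha(t)$ be the number of labellings, up to isomorphism, of the non-root nodes of $t$ by $1,\dots,|t|-1$ that increase along the paths leaving the root, and, for $\psi(z)=1/(1-z)$, let $\delta_t=\psi^{(k)}(0)\prod_i\delta_{t_i}$. Put $a^x(u,v)=1_{[0,u]}(v)$, $a^y(u,v)=1_{[u,1]}(v)$ and $$\phi^x_u(t)=\prod_{i=1}^k\int_0^1 a^x(u,v)\,\phi^y_v(t_i)\,dv,\qquad \phi^y_u(t)=\prod_{i=1}^k\int_0^1 a^y(u,v)\,\phi^x_v(t_i)\,dv$$ (both equal to $1$ for the tree with one node). For $u\in[0,1]$ consider the formal power series in $s$ $$X_u(s)=\sum_{t\in\mathcal R}\frac{s^{|t|}}{|t|!}\alpha(t)\,t!\,\delta_t\int_0^1 a^x(u,v)\phi^y_v(t)\,dv,\qquad Y_u(s)=\sum_{t\in\mathcal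 R}\frac{s^{|t|}}{|t|!}\alpha(t)\,t!\,\delta_t\int_0^1 a^y(u,v)\phi^x_v(t)\,dv .$$ Let $T$ be a Dykema–Haagerup triangular operator: $T$ lies in a unital $*$-algebra $\mathcal A\supset\mathcal B=\mathbb C[x]$ with a conditional expectation $E:\mathcal A\to\mathcal B$ (linear, $E(1)=1$, $E(b_1ab_2)=b_1E(a)b_2$), and there is a bilinear $\kappa:\mathcal A\times\mathcal A\to\mathcal B$ with $\kappa(ba_1,a_2)=b\,\kappa(a_1,a_2)$, $\kappa(a_1b,a_2)=\kappa(a_1,ba_2)$, $\kappa(a_1,a_2b)=\kappa(a_1,a_2)b$ such that, for all $b_i\in\mathcal B$ and $s_i\in\{1,*\}$, $E(b_1T^{s_1}\cdots b_{2n}T^{s_{2n}})=\sum_\sigma\kappa_\sigma(b_1T^{s_1},\dots,b_{2n}T^{s_{2n}})$ and $E(b_1T^{s_1}\cdots b_{2n+1}T^{s_{2n+1}})=0$, where $\sigma$ runs over the noncrossing fixed-point-free involutions of $\{1,\dots,2n\}$ and $\kappa_\sigma$ evaluates the word, parenthesized by $\sigma$, with the product $\kappa$; moreover, for all $b\in\mathbb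 C[x]$ and $x\in[0,1]$, $\kappa(T,bT^*)(x)=\int_x^1 b(s)\,ds$, $\kappa(T^*,bT)(x)=\int_0^x b(s)\,ds$ and $\kappa(T,bT)=\kappa(T^*,bT^*)=0$. Let $\tau(a)=\int_0^1 E(a)(s)\,ds$. Then $(X_u,Y_u)_{u\in[0,1]}$ is the unique solution in formal power series (with the integrals taken coefficientwise) of the integral system $$X_u(s)=s\int_0^1 a^x(u,v)\,\psi(Y_v(s))\,dv,\qquad Y_u(s)=s\int_0^1 a^y(u,v)\,\psi(X_v(s))\,dv\qquad(u\in[0,1]),$$ and $$Y_0(s)=\sum_{t\in\mathcal R}\frac{s^{|t|}}{|t|!}\alpha(t)\,t!\,\delta_t\int_0^1\phi^x_v(t)\,dv=\sum_{t\in\mathcal F}s^{|t|}\int_0^1\phi^x_v(t)\,dv=\sum_{n\ge1}s^{n}\,\tau\big((TT^*)^{n-1}\big).$$ Thus the integral system yields the generating function of the moments $\tau((TT^*)^n)$. -/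

import Mathlib

open scoped PowerSeries Polynomial Nat

noncomputable section

/-! ### Rooted plane trees and rooted trees -/

/-- A rooted plane tree: a root together with the linearly ordered list of the subtrees rooted at
its children. -/
inductive PlaneTree : Type
  | node : List PlaneTree → PlaneTree

namespace PlaneTree

/-- The number `|t|` of nodes. -/
def order : PlaneTree → ℕ
  | node l => 1 + (l.map fun t => order t).sum

/-- The tree factorial: `t! = |t| ∏ tᵢ!`, the product being over the subtrees at the root. -/
def treeFactorial : PlaneTree → ℕ
  | node l => order (node l) * (l.map fun t => treeFactorial t).prod

/-- The elementary differential: `δ_t = ψ⁽ᵏ⁾(0) ∏ δ_{tᵢ}`, where `k` is the number of children of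
the root and `ψ⁽ᵏ⁾(0) = k! ψ_k`. -/
def elemDiff (ψ : ℝ⟦X⟧) : PlaneTree → ℝ
  | node l => (l.length ! : ℝ) * PowerSeries.coeff l.length ψ * (l.map fun t => elemDiff ψ t).prod

/-- The alternating iterated integrals. For kernels `a` and `b`,
`phi a b t u = ∏ᵢ ∫₀¹ a(u,v) phi b a tᵢ v dv`, the product being over the subtrees at the root, so
that `φˣ = phi aˣ aʸ` and `φʸ = phi aʸ aˣ`. -/
def phi (a b : ℝ → ℝ → ℝ) : PlaneTree → ℝ → ℝ
  | node l => fun u => (l.map fun t => ∫ v in (0 : ℝ)..1, a u v * phi b a t v).prod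
termination_by t => t

/-- Two plane trees are isomorphic as rooted trees: the smallest equivalence relation which
allows to permute the subtrees at the root and to replace one of them by an isomorphic tree. -/
inductive Iso : PlaneTree → PlaneTree → Prop
  | perm {l l' : List PlaneTree} : l.Perm l' → Iso (node l) (node l')
  | replace (l r : List PlaneTree) {s t : PlaneTree} :
      Iso s t → Iso (node (l ++ s :: r)) (node (l ++ t :: r))
  | refl (t : PlaneTree) : Iso t t
  | symm {s t : PlaneTree} : Iso s t → Iso t s
  | trans {s t u : PlaneTree} : Iso s t → Iso t u → Iso s u

theorem Iso.order_eq {s t : PlaneTree} (h : Iso s t) : s.order = t.order := by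
  induction h with
  | perm h => simp only [order]; rw [(h.map _).sum_eq]
  | replace l r _ ih => simp [order, ih]
  | refl => rfl
  | symm _ ih => exact ih.symm
  | trans _ _ ih₁ ih₂ => exact ih₁.trans ih₂

theorem Iso.treeFactorial_eq {s t : PlaneTree} (h : Iso s t) :
    s.treeFactorial = t.treeFactorial := by
  induction h with
  | perm h => simp only [treeFactorial]; rw [(h.map _).prod_eq, (Iso.perm h).order_eq]
  | replace l r h ih =>
    simp only [treeFactorial]; rw [(Iso.replace l r h).order_eq]; simp [ih]
  | refl => rfl
  | symm _ ih => exact ih.symm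
  | trans _ _ ih₁ ih₂ => exact ih₁.trans ih₂

theorem Iso.elemDiff_eq (ψ : ℝ⟦X⟧) {s t : PlaneTree} (h : Iso s t) :
    s.elemDiff ψ = t.elemDiff ψ := by
  induction h with
  | perm h => simp only [elemDiff]; rw [(h.map _).prod_eq, h.length_eq]
  | replace l r h ih => simp [elemDiff, ih]
  | refl => rfl
  | symm _ ih => exact ih.symm
  | trans _ _ ih₁ ih₂ => exact ih₁.trans ih₂

theorem Iso.phi_eq {s t : PlaneTree} (h : Iso s t) :
    ∀ (a b : ℝ → ℝ → ℝ), s.phi a b = t.phi a b := by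
  induction h with
  | perm h => intro a b; funext u; simp only [phi]; rw [(h.map _).prod_eq]
  | replace l r h ih => intro a b; funext u; simp [phi, ih]
  | refl => intro a b; rfl
  | symm _ ih => intro a b; exact (ih a b).symm
  | trans _ _ ih₁ ih₂ => intro a b; exact (ih₁ a b).trans (ih₂ a b)

instance isoSetoid : Setoid PlaneTree where
  r := Iso
  iseqv := ⟨Iso.refl, Iso.symm, Iso.trans⟩

theorem order_pos (t : PlaneTree) : 0 < t.order := by
  cases t; simp [order]

theorem length_le_sum_order (l : List PlaneTree) : l.length ≤ (l.map order).sum := by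
  induction l with
  | nil => simp
  | cons t l ih => have := t.order_pos; simp; omega

theorem finite_order_lt (n : ℕ) : {t : PlaneTree | t.order < n}.Finite := by
  induction n with
  | zero => simp
  | succ n ih =>
    have := ih.to_subtype
    refine ((List.finite_length_le {t : PlaneTree | t.order < n} n).image
      (fun l => node (l.map Subtype.val))).subset ?_
    rintro ⟨l⟩ hl
    have hl : 1 + (l.map order).sum < n + 1 := by simpa [order] using hl
    have hmem : ∀ t ∈ l, t ∈ {t : PlaneTree | t.order < n} := fun t ht => by
      have := List.single_le_sum (l := l.map order) (by simp) t.order (List.mem_map_of_mem ht)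
      simp only [Set.mem_ofPred_eq]; omega
    have hlen := length_le_sum_order l
    refine ⟨l.attach.map fun t => ⟨t.1, hmem t.1 t.2⟩, ?_, ?_⟩
    · simp; omega
    · simp [List.map_map, Function.comp_def]

theorem finite_order_eq (n : ℕ) : {t : PlaneTree | t.order = n}.Finite :=
  (finite_order_lt (n + 1)).subset fun t (ht : t.order = n) => by
    simp only [Set.mem_ofPred_eq]; omega

/-- The finite set of the rooted plane trees with `n` nodes. -/
def ofOrder (n : ℕ) : Finset PlaneTree := (finite_order_eq n).toFinset

end PlaneTree

/-- Rooted trees: plane trees up to isomorphism of rooted trees, i.e. without the linear orders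
on the sets of children. -/
def RTree : Type := Quotient PlaneTree.isoSetoid

namespace RTree

/-- The number `|t|` of nodes. -/
def order (t : RTree) : ℕ :=
  Quotient.lift PlaneTree.order (fun _ _ h => PlaneTree.Iso.order_eq h) t

/-- The tree factorial `t!`. -/
def treeFactorial (t : RTree) : ℕ :=
  Quotient.lift PlaneTree.treeFactorial (fun _ _ h => PlaneTree.Iso.treeFactorial_eq h) t

/-- The elementary differential `δ_t`. -/
def elemDiff (ψ : ℝ⟦X⟧) (t : RTree) : ℝ :=
  Quotient.lift (PlaneTree.elemDiff ψ) (fun _ _ h => PlaneTree.Iso.elemDiff_eq ψ h) t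

/-- The iterated integrals: `φˣ_u(t) = phi aˣ aʸ t u` and `φʸ_u(t) = phi aʸ aˣ t u`. -/
def phi (a b : ℝ → ℝ → ℝ) (t : RTree) : ℝ → ℝ :=
  Quotient.lift (PlaneTree.phi a b) (fun _ _ h => PlaneTree.Iso.phi_eq h a b) t

theorem finite_order_eq (n : ℕ) : {t : RTree | t.order = n}.Finite :=
  ((PlaneTree.finite_order_eq n).image (Quotient.mk PlaneTree.isoSetoid)).subset fun t => by
    induction t using Quotient.inductionOn with
    | h t => exact fun ht => ⟨t, ht, rfl⟩

/-- The finite set of the rooted trees with `n` nodes. -/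
def ofOrder (n : ℕ) : Finset RTree := (finite_order_eq n).toFinset

end RTree

/-- Rooted labelled trees with `m + 1` nodes whose labels increase along the paths that start at
the root: the nodes are their labels `0, …, m`, the root is `0`, and `p i` is the parent of the
node `i + 1`, one of `0, …, i`. -/
abbrev IncreasingTree (m : ℕ) : Type := (i : Fin m) → Fin (i.val + 1)

namespace IncreasingTree

/-- The subtree spanned by the node `v` and its descendants. -/
def subtree {m : ℕ} (p : IncreasingTree m) (v : ℕ) : PlaneTree :=
  .node (((List.finRange m).filter fun i => (p i).val = v).attach.map fun i =>
    subtree p (i.1.val + 1))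
termination_by m - v
decreasing_by
  have h := i.2
  simp only [List.mem_filter, decide_eq_true_eq] at h
  have _h₁ := (p i.1).isLt
  have _h₂ := i.1.isLt
  omega

/-- The rooted tree obtained by forgetting the labels. -/
def shape {m : ℕ} (p : IncreasingTree m) : RTree :=
  Quotient.mk PlaneTree.isoSetoid (p.subtree 0)

end IncreasingTree

namespace RTree

/-- The number `α(t)` of rooted labelled trees of shape `t`. -/
def alpha (t : RTree) : ℕ :=
  Nat.card {p : IncreasingTree (t.order - 1) // p.shape = t}

/-- The formal power series `∑_t s^|t| / |t|! · α(t) t! δ_t f(t)`, the sum being over all rooted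
trees. -/
def series (ψ : ℝ⟦X⟧) (f : RTree → ℝ) : ℝ⟦X⟧ :=
  PowerSeries.mk fun n =>
    ∑ t ∈ ofOrder n, (t.alpha : ℝ) * (t.treeFactorial : ℝ) * t.elemDiff ψ / (n ! : ℝ) * f t

end RTree

/-! ### The P-series and the integral system -/

/-- The P-series
`c + ∑_t s^|t| / |t|! · α(t) t! δ_t ∫₀¹ a(u,v) φ_v(t) dv` with `φ_v(t) = phi b a t v`.
For `(a, b) = (aˣ, aʸ)` and `c = X₀` it is `X_u`; for `(a, b) = (aʸ, aˣ)` and `c = Y₁` it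
is `Y_u`. -/
def pSeries (ψ : ℝ⟦X⟧) (a b : ℝ → ℝ → ℝ) (c : ℝ) (u : ℝ) : ℝ⟦X⟧ :=
  PowerSeries.C c +
    RTree.series ψ fun t => ∫ v in (0 : ℝ)..1, a u v * RTree.phi b a t v

/-- One line of the integral system, as an identity of formal power series in `s` whose
coefficients are integrated one by one: for all `u ∈ [0,1]`,
`Z_u(s) = c + s ∫₀¹ a(u,v) ψ(W_v(s)) dv`, all the integrals being those of integrable functions. -/
def SolvesIntegralEq (ψ : ℝ⟦X⟧) (a : ℝ → ℝ → ℝ) (c : ℝ) (Z W : ℝ → ℝ⟦X⟧) : Prop :=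
  ∀ u ∈ Set.Icc (0 : ℝ) 1,
    (∀ n : ℕ, IntervalIntegrable
      (fun v => a u v * PowerSeries.coeff n (PowerSeries.subst (W v) ψ : ℝ⟦X⟧))
      MeasureTheory.volume 0 1) ∧
    Z u = PowerSeries.C c + PowerSeries.X * PowerSeries.mk fun n : ℕ =>
      ∫ v in (0 : ℝ)..1, a u v * PowerSeries.coeff n (PowerSeries.subst (W v) ψ : ℝ⟦X⟧)

/-- `(X, Y)` is a solution of the integral system with the kernels `aˣ = ax`, `aʸ = ay`. -/
def SolvesIntegralSystem (ψ : ℝ⟦X⟧) (ax ay : ℝ → ℝ → ℝ) (X₀ Y₁ : ℝ) (X Y : ℝ → ℝ⟦X⟧) : Prop :=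
  SolvesIntegralEq ψ ax X₀ X Y ∧ SolvesIntegralEq ψ ay Y₁ Y X

/-- `aˣ(u,v) = 1_{[0,u]}(v)`. -/
def kernelX (u v : ℝ) : ℝ := (Set.Icc 0 u).indicator 1 v

/-- `aʸ(u,v) = 1_{[u,1]}(v)`. -/
def kernelY (u v : ℝ) : ℝ := (Set.Icc u 1).indicator 1 v

/-! ### The triangular operator -/

/-- The involution of the *-algebra `ℂ[x]` conjugates the coefficients. -/
instance polynomialStarRing : StarRing ℂ[X] where
  star p := p.map (starRingEnd ℂ)
  star_involutive p := by ext; simp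
  star_mul p q := by simp [mul_comm]
  star_add p q := by simp

instance polynomialStarModule : StarModule ℂ ℂ[X] where
  star_smul c p := by
    change (c • p).map (starRingEnd ℂ) = star c • p.map (starRingEnd ℂ)
    ext; simp

/-- An operator valued probability space: a unital *-algebra `A`, a unital *-subalgebra `B`, given
by its inclusion map, and a conditional expectation `E : A → B`. -/
structure OpValuedProbSpace (B A : Type*) [Ring B] [StarRing B] [Algebra ℂ B] [StarModule ℂ B]
    [Ring A] [StarRing A] [Algebra ℂ A] [StarModule ℂ A] where
  incl : B →⋆ₐ[ℂ] A
  incl_injective : Function.Injective incl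
  E : A →ₗ[ℂ] B
  E_one : E 1 = 1
  E_bimod : ∀ (b₁ b₂ : B) (a : A), E (incl b₁ * a * incl b₂) = b₁ * E a * b₂

/-- The involutions of `{0, …, m - 1}` without fixed point and without crossing. -/
def nonCrossingInvolutions (m : ℕ) : Finset (Equiv.Perm (Fin m)) := by
  classical
  exact {σ | (∀ i, σ (σ i) = i) ∧ (∀ i, σ i ≠ i) ∧ ¬ ∃ i j, i < j ∧ j < σ i ∧ σ i < σ j}

section GeneralizedCircular

variable {B A : Type*} [Ring B] [StarRing B] [Algebra ℂ B] [StarModule ℂ B]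
  [Ring A] [StarRing A] [Algebra ℂ A] [StarModule ℂ A]

/-- The evaluation in `B` of the subword `a_i ⋯ a_{j-1}` of the word `a_0 ⋯ a_{m-1}`, with the
parentheses of the noncrossing involution `σ`, for the product `a₁ • a₂ = κ(a₁, a₂)`: with
`k = σ i`, this is `((a_i · [a_{i+1} ⋯ a_{k-1}]) • a_k) · [a_{k+1} ⋯ a_{j-1}]`, and the empty word
evaluates to `1`. -/
def evalSubword (ι : B →⋆ₐ[ℂ] A) (κ : A →ₗ[ℂ] A →ₗ[ℂ] B) {m : ℕ}
    (σ : Equiv.Perm (Fin m)) (a : Fin m → A) (i j : ℕ) : B :=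
  if hi : i < m then
    let k := σ ⟨i, hi⟩
    if i < k.val ∧ k.val < j then
      κ (a ⟨i, hi⟩ * ι (evalSubword ι κ σ a (i + 1) k.val)) (a k) *
        evalSubword ι κ σ a (k.val + 1) j
    else 1
  else 1
termination_by j - i

/-- The map `κ_σ`. -/
def kappaSigma (ι : B →⋆ₐ[ℂ] A) (κ : A →ₗ[ℂ] A →ₗ[ℂ] B) {m : ℕ}
    (σ : Equiv.Perm (Fin m)) (a : Fin m → A) : B :=
  evalSubword ι κ σ a 0 m

/-- The rules for `a₁ • a₂ = κ(a₁, a₂)`: `(b a₁) • a₂ = b (a₁ • a₂)`, `(a₁ b) • a₂ = a₁ • (b a₂)`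
and `a₁ • (a₂ b) = (a₁ • a₂) b`. -/
structure IsBimoduleProduct (ι : B →⋆ₐ[ℂ] A) (κ : A →ₗ[ℂ] A →ₗ[ℂ] B) : Prop where
  left : ∀ (b : B) (a₁ a₂ : A), κ (ι b * a₁) a₂ = b * κ a₁ a₂
  middle : ∀ (b : B) (a₁ a₂ : A), κ (a₁ * ι b) a₂ = κ a₁ (ι b * a₂)
  right : ∀ (b : B) (a₁ a₂ : A), κ a₁ (a₂ * ι b) = κ a₁ a₂ * b

/-- `T^s` for `s ∈ {1, *}`, where `true` stands for `*`. -/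
def starPower (T : A) (s : Bool) : A := if s then star T else T

/-- `T` is a generalized circular element, with covariance `κ`. -/
structure IsGeneralizedCircularWith (S : OpValuedProbSpace B A) (κ : A →ₗ[ℂ] A →ₗ[ℂ] B)
    (T : A) : Prop where
  bimodule : IsBimoduleProduct S.incl κ
  even : ∀ (n : ℕ) (b : Fin (2 * n) → B) (s : Fin (2 * n) → Bool),
    S.E (List.ofFn fun i => S.incl (b i) * starPower T (s i)).prod =
      ∑ σ ∈ nonCrossingInvolutions (2 * n),
        kappaSigma S.incl κ σ fun i => S.incl (b i) * starPower T (s i)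
  odd : ∀ (n : ℕ) (b : Fin (2 * n + 1) → B) (s : Fin (2 * n + 1) → Bool),
    S.E (List.ofFn fun i => S.incl (b i) * starPower T (s i)).prod = 0

end GeneralizedCircular

section Triangular

variable {A : Type*} [Ring A] [StarRing A] [Algebra ℂ A] [StarModule ℂ A]

/-- `T` is a Dykema–Haagerup triangular operator: a generalized circular element over `ℂ[x]` with
`κ(T, bT*)(x) = ∫ₓ¹ b(s) ds`, `κ(T*, bT)(x) = ∫₀ˣ b(s) ds` and
`κ(T, bT) = κ(T*, bT*) = 0`. -/
def IsTriangularOperator (S : OpValuedProbSpace ℂ[X] A) (T : A) : Prop :=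
  ∃ κ : A →ₗ[ℂ] A →ₗ[ℂ] ℂ[X], IsGeneralizedCircularWith S κ T ∧
    (∀ b : ℂ[X], ∀ x ∈ Set.Icc (0 : ℝ) 1,
      (κ T (S.incl b * star T)).eval (x : ℂ) = ∫ s in x..1, b.eval (s : ℂ)) ∧
    (∀ b : ℂ[X], ∀ x ∈ Set.Icc (0 : ℝ) 1,
      (κ (star T) (S.incl b * T)).eval (x : ℂ) = ∫ s in (0 : ℝ)..x, b.eval (s : ℂ)) ∧
    (∀ b : ℂ[X], κ T (S.incl b * T) = 0) ∧
    (∀ b : ℂ[X], κ (star T) (S.incl b * star T) = 0)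

/-- The trace `τ(a) = ∫₀¹ E(a)(s) ds`. -/
def trace (S : OpValuedProbSpace ℂ[X] A) (a : A) : ℂ :=
  ∫ s in (0 : ℝ)..1, (S.E a).eval (s : ℂ)

end Triangular

/-! ### Existence of the triangular operator

`exists_triangularOperator`: on the free algebra generated by `x`, `T`, `T*`, the formula for the
moments of a generalized circular element defines a conditional expectation for which `T` is a
triangular operator. -/

section Multilinear

variable {B A : Type*} [Ring B] [StarRing B] [Algebra ℂ B] [StarModule ℂ B]
  [Ring A] [StarRing A] [Algebra ℂ A] [StarModule ℂ A]

theorem evalSubword_congr (ι : B →⋆ₐ[ℂ] A) (κ : A →ₗ[ℂ] A →ₗ[ℂ] B) {m : ℕ}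
    (σ : Equiv.Perm (Fin m)) (a a' : Fin m → A) (i j : ℕ)
    (h : ∀ q : Fin m, i ≤ q.val → q.val < j → a q = a' q) :
    evalSubword ι κ σ a i j = evalSubword ι κ σ a' i j := by
  induction hn : j - i using Nat.strong_induction_on generalizing i j with
  | _ n ih =>
    subst hn
    unfold evalSubword
    split_ifs with hi
    · dsimp only
      split_ifs with hk
      · rw [ih _ (by omega) _ _ (fun q hq hq' => h q (by omega) (by omega)) rfl,
          ih _ (by omega) _ _ (fun q hq hq' => h q (by omega) (by omega)) rfl,
          h ⟨i, hi⟩ (by simp) (by simp; omega), h (σ ⟨i, hi⟩) (by omega) (by omega)]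
      · rfl
    · rfl

/-- One step of the evaluation. -/
theorem evalSubword_step (ι : B →⋆ₐ[ℂ] A) (κ : A →ₗ[ℂ] A →ₗ[ℂ] B) {m : ℕ}
    (σ : Equiv.Perm (Fin m)) (a : Fin m → A) (i : Fin m) (j : ℕ)
    (h : i < σ i) (h' : (σ i).val < j) :
    evalSubword ι κ σ a i j = κ (a i * ι (evalSubword ι κ σ a (i + 1) (σ i))) (a (σ i)) *
      evalSubword ι κ σ a (σ i + 1) j := by
  conv_lhs => unfold evalSubword
  rw [dif_pos i.2]
  have h : i.val < (σ i).val := h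
  simp [h, h']

theorem mem_nonCrossing {m : ℕ} {σ : Equiv.Perm (Fin m)} :
    σ ∈ nonCrossingInvolutions m ↔
    ((∀ i, σ (σ i) = i) ∧ (∀ i, σ i ≠ i) ∧ ¬ ∃ i j, i < j ∧ j < σ i ∧ σ i < σ j) := by
  simp [nonCrossingInvolutions]

/-- `σ` maps `{i, …, j - 1}` into itself. -/
def IntervalClosed {m : ℕ} (σ : Equiv.Perm (Fin m)) (i j : ℕ) : Prop :=
  ∀ q : Fin m, i ≤ q.val → q.val < j → i ≤ (σ q).val ∧ (σ q).val < j

theorem intervalClosed_split {m : ℕ} {σ : Equiv.Perm (Fin m)} (hσ : σ ∈ nonCrossingInvolutions m)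
    (i : Fin m) (j : ℕ) (hij : i.val < j) (hc : IntervalClosed σ i j) :
    i < σ i ∧ (σ i).val < j ∧ IntervalClosed σ (i + 1) (σ i) ∧ IntervalClosed σ (σ i + 1) j := by
  obtain ⟨h1, h2, h3⟩ := mem_nonCrossing.1 hσ
  push Not at h3
  have ha := hc i le_rfl hij
  have hb : (σ i).val ≠ i.val := fun h => h2 i (Fin.ext h)
  have hlt : i < σ i := Fin.lt_def.2 (by omega)
  have key : ∀ q : Fin m, i < q → q < σ i → i < σ q ∧ σ q < σ i := by
    intro q hq hq'
    have e1 : σ q ≠ σ i := fun h => hq.ne' (σ.injective h)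
    have e2 : σ q ≠ i := fun h => by rw [← h, h1] at hq'; exact lt_irrefl _ hq'
    have := h3 i q hq hq'
    have := hc q (le_of_lt hq) (lt_of_lt_of_le hq' (by exact ha.2.le))
    refine ⟨lt_of_le_of_ne (Fin.le_def.2 this.1) e2.symm, lt_of_le_of_ne ?_ e1⟩
    assumption
  refine ⟨hlt, ha.2, fun q hq hq' => ?_, fun q hq hq' => ?_⟩
  · have := key q (Fin.lt_def.2 (by omega)) (Fin.lt_def.2 hq')
    exact ⟨this.1, this.2⟩
  · have hw := hc q (by omega) hq'
    refine ⟨?_, hw.2⟩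
    by_contra hcon
    rcases lt_trichotomy (σ q).val i.val with h | h | h
    · omega
    · have : σ q = i := Fin.ext h
      rw [← this, h1] at hq; omega
    · rcases lt_trichotomy (σ q).val (σ i).val with h' | h' | h'
      · have := (key (σ q) (Fin.lt_def.2 h) (Fin.lt_def.2 h')).2
        rw [h1] at this
        have : q.val < (σ i).val := this
        omega
      · have : q = i := σ.injective (Fin.ext h')
        subst this; omega
      · omega

theorem evalSubword_linear (ι : B →⋆ₐ[ℂ] A) (κ : A →ₗ[ℂ] A →ₗ[ℂ] B) {m : ℕ}
    {σ : Equiv.Perm (Fin m)} (hσ : σ ∈ nonCrossingInvolutions m) (p : Fin m) (a : Fin m → A)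
    (i j : ℕ) (hj : j ≤ m) (hc : IntervalClosed σ i j) (hp : i ≤ p.val) (hp' : p.val < j) :
    ∃ F : A →ₗ[ℂ] B, ∀ x, evalSubword ι κ σ (Function.update a p x) i j = F x := by
  induction hn : j - i using Nat.strong_induction_on generalizing i j with
  | _ n ih =>
    subst hn
    have hi : i < m := by omega
    obtain ⟨c1, c2, c3, c4⟩ := intervalClosed_split hσ ⟨i, hi⟩ j (by simp; omega) hc
    have c1' : i < (σ ⟨i, hi⟩).val := c1
    have step : ∀ x, evalSubword ι κ σ (Function.update a p x) i j =
        κ (Function.update a p x ⟨i, hi⟩ *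
          ι (evalSubword ι κ σ (Function.update a p x) (i + 1) (σ ⟨i, hi⟩)))
          (Function.update a p x (σ ⟨i, hi⟩)) *
        evalSubword ι κ σ (Function.update a p x) (σ ⟨i, hi⟩ + 1) j :=
      fun x => evalSubword_step ι κ σ (Function.update a p x) ⟨i, hi⟩ j c1 c2
    have un : ∀ i' j', (p.val < i' ∨ j' ≤ p.val) → ∀ x,
        evalSubword ι κ σ (Function.update a p x) i' j' = evalSubword ι κ σ a i' j' := by
      intro i' j' h x
      refine evalSubword_congr ι κ σ _ _ _ _ fun q hq hq' => Function.update_of_ne ?_ _ _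
      rintro rfl; omega
    have ua : ∀ q, q ≠ p → ∀ x, Function.update a p x q = a q :=
      fun q hq x => Function.update_of_ne hq _ _
    rcases lt_trichotomy p.val (σ ⟨i, hi⟩).val with h | h | h
    · rcases hp.eq_or_lt with h' | h'
      · have e : (⟨i, hi⟩ : Fin m) = p := Fin.ext h'
        refine ⟨(LinearMap.mulRight ℂ (evalSubword ι κ σ a (σ ⟨i, hi⟩ + 1) j)) ∘ₗ
          (κ.flip (a (σ ⟨i, hi⟩))) ∘ₗ
          LinearMap.mulRight ℂ (ι (evalSubword ι κ σ a (i + 1) (σ ⟨i, hi⟩))), fun x => ?_⟩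
        refine (step x).trans ?_
        rw [un _ _ (by omega), un _ _ (by omega), ua (σ ⟨i, hi⟩) (by intro h; rw [h] at c1'; omega)]
        subst e; simp
      · obtain ⟨F, hF⟩ := ih _ (by omega) (i + 1) (σ ⟨i, hi⟩) (by omega) c3 (by omega) h rfl
        refine ⟨(LinearMap.mulRight ℂ (evalSubword ι κ σ a (σ ⟨i, hi⟩ + 1) j)) ∘ₗ
          (κ.flip (a (σ ⟨i, hi⟩))) ∘ₗ
          LinearMap.mulLeft ℂ (a ⟨i, hi⟩) ∘ₗ ι.toAlgHom.toLinearMap ∘ₗ F, fun x => ?_⟩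
        refine (step x).trans ?_
        rw [un (σ ⟨i, hi⟩ + 1) j (by omega), ua (σ ⟨i, hi⟩) (by intro h'; rw [h'] at h; omega),
          ua ⟨i, hi⟩ (by rintro rfl; simp at h'), hF]
        simp
    · have e : σ ⟨i, hi⟩ = p := Fin.ext h.symm
      refine ⟨(LinearMap.mulRight ℂ (evalSubword ι κ σ a (σ ⟨i, hi⟩ + 1) j)) ∘ₗ
          (κ (a ⟨i, hi⟩ * (ι (evalSubword ι κ σ a (i + 1) (σ ⟨i, hi⟩))))), fun x => ?_⟩
      refine (step x).trans ?_
      rw [un _ _ (by omega), un _ _ (by omega), ua ⟨i, hi⟩ (by rintro rfl; simp at h; omega)]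
      rw [e]; simp
    · obtain ⟨F, hF⟩ := ih _ (by omega) (σ ⟨i, hi⟩ + 1) j hj c4 (by omega) hp' rfl
      refine ⟨LinearMap.mulLeft ℂ (κ (a ⟨i, hi⟩ * (ι (evalSubword ι κ σ a (i + 1) (σ ⟨i, hi⟩)))) (a (σ ⟨i, hi⟩))) ∘ₗ F,
        fun x => ?_⟩
      refine (step x).trans ?_
      rw [un (i + 1) (σ ⟨i, hi⟩) (by omega), ua (σ ⟨i, hi⟩) (by rintro rfl; omega),
          ua ⟨i, hi⟩ (by rintro rfl; simp at h; omega), hF]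
      simp

theorem intervalClosed_full {m : ℕ} (σ : Equiv.Perm (Fin m)) : IntervalClosed σ 0 m :=
  fun q _ _ => ⟨Nat.zero_le _, (σ q).isLt⟩

/-- `κ_σ` is multilinear. -/
def kappaSigmaMultilinear (ι : B →⋆ₐ[ℂ] A) (κ : A →ₗ[ℂ] A →ₗ[ℂ] B) {m : ℕ}
    (σ : Equiv.Perm (Fin m)) (hσ : σ ∈ nonCrossingInvolutions m) :
    MultilinearMap ℂ (fun _ : Fin m => A) B where
  toFun := kappaSigma ι κ σ
  map_update_add' {inst} a p x y := by
    rw [Subsingleton.elim inst (instDecidableEqFin m)]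
    obtain ⟨F, hF⟩ := evalSubword_linear ι κ hσ p a 0 m le_rfl (intervalClosed_full σ) (by simp) p.2
    simp [kappaSigma, hF]
  map_update_smul' {inst} a p c x := by
    rw [Subsingleton.elim inst (instDecidableEqFin m)]
    obtain ⟨F, hF⟩ := evalSubword_linear ι κ hσ p a 0 m le_rfl (intervalClosed_full σ) (by simp) p.2
    simp [kappaSigma, hF]

theorem kappaSigma_left (ι : B →⋆ₐ[ℂ] A) (κ : A →ₗ[ℂ] A →ₗ[ℂ] B) (hκ : IsBimoduleProduct ι κ)
    {m : ℕ} {σ : Equiv.Perm (Fin (m + 1))} (hσ : σ ∈ nonCrossingInvolutions (m + 1)) (b : B)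
    (a a' : Fin (m + 1) → A) (h0 : a' 0 = ι b * a 0) (h : ∀ i, i ≠ 0 → a' i = a i) :
    kappaSigma ι κ σ a' = b * kappaSigma ι κ σ a := by
  unfold kappaSigma
  obtain ⟨c1, c2, -, -⟩ := intervalClosed_split hσ 0 (m + 1) (by simp) (intervalClosed_full σ)
  have s1 : evalSubword ι κ σ a 0 (m + 1) = κ (a 0 * ι (evalSubword ι κ σ a 1 (σ 0))) (a (σ 0)) *
      evalSubword ι κ σ a (σ 0 + 1) (m + 1) := evalSubword_step ι κ σ a 0 (m + 1) c1 c2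
  have s2 : evalSubword ι κ σ a' 0 (m + 1) =
      κ (a' 0 * ι (evalSubword ι κ σ a' 1 (σ 0))) (a' (σ 0)) *
      evalSubword ι κ σ a' (σ 0 + 1) (m + 1) := evalSubword_step ι κ σ a' 0 (m + 1) c1 c2
  have c : ∀ i j, 0 < i → evalSubword ι κ σ a' i j = evalSubword ι κ σ a i j := fun i j hi =>
    evalSubword_congr _ _ _ _ _ _ _ fun q hq _ => h q (by rintro rfl; simp at hq; omega)
  rw [s1, s2, c _ _ (by simp), c _ _ (by simp), h _ c1.ne', h0, mul_assoc (ι b), hκ.left, mul_assoc]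

end Multilinear

section TriangularModel

/-- The free algebra on three letters: `none` is `x`, `some false` is `T`, `some true` is `T*`. -/
abbrev TriangularModel : Type := MonoidAlgebra ℂ (FreeMonoid (Option Bool))

namespace TriangularModel

/-- The monomial of a word. -/
def word (w : List (Option Bool)) : TriangularModel := MonoidAlgebra.single (FreeMonoid.ofList w) 1

theorem word_mul (w w' : List (Option Bool)) : word w * word w' = word (w ++ w') := by
  simp [word, MonoidAlgebra.single_mul_single]

theorem word_nil : word [] = 1 := rfl

theorem span_induction {P : TriangularModel → Prop} (h0 : P 0) (ha : ∀ a b, P a → P b → P (a + b))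
    (hs : ∀ w (c : ℂ), P (c • word w)) (a : TriangularModel) : P a := by
  induction a using MonoidAlgebra.induction_linear with
  | zero => exact h0
  | add a b h1 h2 => exact ha a b h1 h2
  | single w c =>
    have := hs (FreeMonoid.toList w) c
    simpa [word] using this

/-- The linear antiautomorphism with `x ↦ x` and `T ↔ T*`. -/
def anti : TriangularModel →ₐ[ℂ] TriangularModelᵐᵒᵖ :=
  MonoidAlgebra.lift ℂ (TriangularModelᵐᵒᵖ) _ (FreeMonoid.lift fun l => .op (word [l.map not]))

theorem anti_word (w : List (Option Bool)) :
    (anti (word w)).unop = word (w.map (Option.map not)).reverse := by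
  induction w with
  | nil => simp [word_nil]
  | cons l w ih =>
    have : word (l :: w) = word [l] * word w := by rw [word_mul]; rfl
    rw [this, map_mul, MulOpposite.unop_mul, ih]
    have : (anti (word [l])).unop = word [l.map not] := by
      simp [anti, word, MonoidAlgebra.lift_single]
    rw [this, word_mul]; simp

/-- Conjugation of the coefficients. -/
def conj : TriangularModel →+* TriangularModel := MonoidAlgebra.mapRingHom _ (starRingEnd ℂ)

theorem conj_smul_word (c : ℂ) (w) : conj (c • word w) = starRingEnd ℂ c • word w := by
  simp [conj, word]

/-- The involution. -/
def st (a : TriangularModel) : TriangularModel := (anti (conj a)).unop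

theorem st_add (a b : TriangularModel) : st (a + b) = st a + st b := by simp [st]
theorem st_smul_word (c : ℂ) (w) :
    st (c • word w) = starRingEnd ℂ c • word (w.map (Option.map not)).reverse := by
  rw [st, conj_smul_word, map_smul, MulOpposite.unop_smul, anti_word]

instance : StarRing TriangularModel where
  star := st
  star_involutive a := by
    induction a using span_induction with
    | h0 => simp [st]
    | ha a b h1 h2 => rw [st_add, st_add, h1, h2]
    | hs w c =>
      rw [st_smul_word, st_smul_word]
      have : (Option.map not ∘ Option.map not) = (id : Option Bool → Option Bool) := by
        funext x; cases x <;> simp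
      simp [this]
  star_mul a b := by simp [st]
  star_add a b := st_add a b

theorem star_def (a : TriangularModel) : star a = st a := rfl

instance : StarModule ℂ TriangularModel where
  star_smul c a := by
    rw [star_def, star_def]
    induction a using span_induction with
    | h0 => simp [st]
    | ha a b h1 h2 => rw [smul_add, st_add, h1, h2, st_add, smul_add]
    | hs w d => rw [smul_smul, st_smul_word, st_smul_word, smul_smul]; simp

theorem star_word (w) : star (word w) = word (w.map (Option.map not)).reverse := by
  have := st_smul_word 1 w
  rw [star_def]
  simpa using this

/-- The generator `x`. -/
def xx : TriangularModel := word [none]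
/-- The generator `T`. -/
def T : TriangularModel := word [some false]

/-- The inclusion of `ℂ[x]`. -/
def incl : ℂ[X] →⋆ₐ[ℂ] TriangularModel where
  toAlgHom := Polynomial.aeval xx
  map_star' p := by
    change Polynomial.aeval xx (p.map (starRingEnd ℂ)) = star (Polynomial.aeval xx p)
    induction p using Polynomial.induction_on' with
    | add p q hp hq => rw [Polynomial.map_add, map_add, hp, hq, map_add, star_add]
    | monomial n c =>
      have : star xx = xx := by rw [xx, star_word]; rfl
      simp [Polynomial.aeval_monomial, star_pow, this, Algebra.algebraMap_eq_smul_one, star_smul]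

theorem incl_X : incl Polynomial.X = xx := Polynomial.aeval_X _

/-- Writes a word as `x^{p₁} T^{s₁} ⋯ x^{pₙ} T^{sₙ} x^k`. -/
def parse : List (Option Bool) → List (ℕ × Bool) × ℕ
  | [] => ([], 0)
  | none :: w => match parse w with
    | ([], k) => ([], k + 1)
    | ((p, s) :: l, k) => ((p + 1, s) :: l, k)
  | some s :: w => ((0, s) :: (parse w).1, (parse w).2)

theorem parse_right (w) : parse (w ++ [none]) = ((parse w).1, (parse w).2 + 1) := by
  induction w with
  | nil => rfl
  | cons l w ih =>
    cases l with
    | none =>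
      simp only [List.cons_append, parse, ih]
      rcases parse w with ⟨_ | ⟨⟨p, s⟩, l⟩, k⟩ <;> rfl
    | some s => simp [parse, ih]

/-- Induction on polynomials. -/
theorem poly_induction {P : ℂ[X] → Prop} (one : P 1) (add : ∀ p q, P p → P q → P (p + q))
    (smul : ∀ (c : ℂ) p, P p → P (c • p)) (mulX : ∀ p, P p → P (p * Polynomial.X)) (p) : P p := by
  have hX : ∀ n, P (Polynomial.X ^ n) := by
    intro n
    induction n with
    | zero => simpa using one
    | succ n ih => rw [pow_succ]; exact mulX _ ih
  induction p using Polynomial.induction_on' with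
  | add p q hp hq => exact add p q hp hq
  | monomial n c =>
    rw [← Polynomial.C_mul_X_pow_eq_monomial, ← Polynomial.smul_eq_C_mul]
    exact smul _ _ (hX n)

theorem model_ext {M : Type*} [AddCommMonoid M] [Module ℂ M] {F G : TriangularModel →ₗ[ℂ] M}
    (h : ∀ w, F (word w) = G (word w)) : F = G := by
  refine LinearMap.ext fun a => ?_
  induction a using span_induction with
  | h0 => simp
  | ha a b h1 h2 => simp [h1, h2]
  | hs w c => simp [h]

/-- The linear map with given values on words. -/
def extend {M : Type*} [AddCommMonoid M] [Module ℂ M] (f : List (Option Bool) → M) :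
    TriangularModel →ₗ[ℂ] M :=
  (MonoidAlgebra.basis (FreeMonoid (Option Bool)) ℂ).constr ℂ fun w => f (FreeMonoid.toList w)

theorem extend_word {M : Type*} [AddCommMonoid M] [Module ℂ M] (f : List (Option Bool) → M) (w) :
    extend f (word w) = f w := by
  have := (MonoidAlgebra.basis (FreeMonoid (Option Bool)) ℂ).constr_basis ℂ
    (fun w => f (FreeMonoid.toList w)) (FreeMonoid.ofList w)
  simpa [word, extend] using this

/-- The antiderivative which vanishes at `0`. -/
def prim : ℂ[X] →ₗ[ℂ] ℂ[X] :=
  (Polynomial.basisMonomials ℂ).constr ℂ fun n => Polynomial.monomial (n + 1) ((n : ℂ) + 1)⁻¹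

theorem prim_eval (b : ℂ[X]) (x : ℝ) :
    (prim b).eval (x : ℂ) = ∫ s in (0 : ℝ)..x, b.eval (s : ℂ) := by
  have hc : ∀ b : ℂ[X], IntervalIntegrable (fun s : ℝ => b.eval (s : ℂ)) MeasureTheory.volume 0 x :=
    fun b => (b.continuous.comp Complex.continuous_ofReal).intervalIntegrable _ _
  induction b using Polynomial.induction_on' with
  | add p q hp hq =>
    simp only [map_add, Polynomial.eval_add, hp, hq]
    exact (intervalIntegral.integral_add (hc p) (hc q)).symm
  | monomial n c =>
    have h1 : prim (Polynomial.monomial n c) = c • Polynomial.monomial (n + 1) ((n : ℂ) + 1)⁻¹ := by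
      have := (Polynomial.basisMonomials ℂ).constr_basis ℂ
        (fun n => Polynomial.monomial (n + 1) ((n : ℂ) + 1)⁻¹) n
      rw [← mul_one c, ← smul_eq_mul, ← Polynomial.smul_monomial, map_smul, smul_eq_mul, mul_one]
      congr 1
    rw [h1]
    have h2 : (∫ s in (0 : ℝ)..x, ((s : ℂ)) ^ n) = (x : ℂ) ^ (n + 1) / (n + 1) := by
      have := integral_pow (a := 0) (b := x) n
      have h3 := congrArg (fun r : ℝ => (r : ℂ)) this
      simp only [← intervalIntegral.integral_ofReal] at h3
      push_cast at h3
      simpa using h3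
    simp only [Polynomial.eval_monomial, intervalIntegral.integral_const_mul, h2,
      Polynomial.eval_smul, smul_eq_mul]
    ring

/-- The values `κ(T^s, b T^s')`. -/
def K (s s' : Bool) : ℂ[X] →ₗ[ℂ] ℂ[X] :=
  match s, s' with
  | false, true => (Polynomial.CAlgHom (A := ℂ) (R := ℂ)).toLinearMap ∘ₗ
      (Polynomial.aeval (1 : ℂ)).toLinearMap ∘ₗ prim - prim
  | true, false => prim
  | _, _ => 0

/-- The map `κ` on words. -/
def kap2 (u v : List (ℕ × Bool) × ℕ) : ℂ[X] :=
  match u, v with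
  | ([(p, s)], q), ([(p', s')], q') => Polynomial.X ^ p * K s s' (Polynomial.X ^ (q + p')) *
      Polynomial.X ^ q'
  | _, _ => 0

/-- The map `κ`. -/
def kap : TriangularModel →ₗ[ℂ] TriangularModel →ₗ[ℂ] ℂ[X] :=
  extend fun w => extend fun w' => kap2 (parse w) (parse w')

theorem kap_word (w w') : kap (word w) (word w') = kap2 (parse w) (parse w') := by
  rw [kap, extend_word, extend_word]

theorem kap_left (a a' : TriangularModel) : kap (xx * a) a' = Polynomial.X * kap a a' := by
  have : kap ∘ₗ LinearMap.mulLeft ℂ xx = kap.compr₂ (LinearMap.mulLeft ℂ Polynomial.X) := by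
    refine model_ext fun w => model_ext fun w' => ?_
    simp only [LinearMap.comp_apply, LinearMap.mulLeft_apply, LinearMap.compr₂_apply, xx, word_mul,
      kap_word, List.cons_append, List.nil_append, parse]
    rcases parse w with ⟨_ | ⟨⟨p, s⟩, _ | l⟩, k⟩ <;>
      rcases parse w' with ⟨_ | ⟨⟨p', s'⟩, _ | l'⟩, k'⟩ <;> simp [kap2, pow_succ]
    ring
  simpa using LinearMap.congr_fun (LinearMap.congr_fun this a) a'

theorem kap_right (a a' : TriangularModel) : kap a (a' * xx) = kap a a' * Polynomial.X := by
  have : kap.compl₂ (LinearMap.mulRight ℂ xx) = kap.compr₂ (LinearMap.mulRight ℂ Polynomial.X) := by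
    refine model_ext fun w => model_ext fun w' => ?_
    simp only [LinearMap.compl₂_apply, LinearMap.mulRight_apply, LinearMap.compr₂_apply, xx,
      word_mul, kap_word, parse_right]
    rcases parse w with ⟨_ | ⟨⟨p, s⟩, _ | l⟩, k⟩ <;>
      rcases parse w' with ⟨_ | ⟨⟨p', s'⟩, _ | l'⟩, k'⟩ <;> simp [kap2, pow_succ]
    ring
  simpa using LinearMap.congr_fun (LinearMap.congr_fun this a) a'

theorem kap_middle (a a' : TriangularModel) : kap (a * xx) a' = kap a (xx * a') := by
  have : kap ∘ₗ LinearMap.mulRight ℂ xx = kap.compl₂ (LinearMap.mulLeft ℂ xx) := by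
    refine model_ext fun w => model_ext fun w' => ?_
    simp only [LinearMap.comp_apply, LinearMap.compl₂_apply, LinearMap.mulRight_apply,
      LinearMap.mulLeft_apply, xx, word_mul, kap_word, parse_right, List.cons_append,
      List.nil_append, parse]
    rcases parse w with ⟨_ | ⟨⟨p, s⟩, _ | l⟩, k⟩ <;>
      rcases parse w' with ⟨_ | ⟨⟨p', s'⟩, _ | l'⟩, k'⟩ <;>
      simp [kap2, add_comm, add_left_comm]
  simpa using LinearMap.congr_fun (LinearMap.congr_fun this a) a'

theorem kap_bimodule : IsBimoduleProduct incl kap where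
  left b := by
    induction b using poly_induction with
    | one => simp
    | add p q hp hq => intro a a'; simp [add_mul, hp, hq]
    | smul c p hp => intro a a'; simp [hp]
    | mulX p hp => intro a a'; rw [map_mul incl, incl_X, mul_assoc, hp, kap_left, mul_assoc]
  middle b := by
    induction b using poly_induction with
    | one => simp
    | add p q hp hq => intro a a'; simp [add_mul, mul_add, hp, hq]
    | smul c p hp => intro a a'; simp [hp]
    | mulX p hp => intro a a'; rw [map_mul incl, incl_X, ← mul_assoc, kap_middle, hp, mul_assoc]
  right b := by
    induction b using poly_induction with
    | one => simp
    | add p q hp hq => intro a a'; simp [mul_add, hp, hq]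
    | smul c p hp => intro a a'; simp [hp]
    | mulX p hp => intro a a'; rw [map_mul incl, incl_X, ← mul_assoc, kap_right, hp, mul_assoc]

/-- The sum of the `κ_σ` on a monomial. -/
def Vsum (f : Σ n, Fin n → ℕ × Bool) : ℂ[X] :=
  ∑ σ ∈ nonCrossingInvolutions f.1, kappaSigma incl kap σ fun i =>
    incl (Polynomial.X ^ (f.2 i).1) * starPower T (f.2 i).2

/-- The conditional expectation on words. -/
def Ew (w : List (Option Bool)) : ℂ[X] :=
  Vsum (List.equivSigmaTuple (parse w).1) * Polynomial.X ^ (parse w).2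

theorem Vsum_left (p s) (l : List (ℕ × Bool)) :
    Vsum (List.equivSigmaTuple ((p + 1, s) :: l)) =
      Polynomial.X * Vsum (List.equivSigmaTuple ((p, s) :: l)) := by
  unfold Vsum
  rw [Finset.mul_sum]
  refine Finset.sum_congr rfl fun σ hσ => ?_
  refine kappaSigma_left incl kap kap_bimodule (m := l.length) hσ _ _ _ ?_ ?_
  · simp [List.equivSigmaTuple, pow_succ', mul_assoc]
  · intro i hi
    obtain ⟨j, rfl⟩ := Fin.exists_succ_eq.2 hi
    rfl

/-- The conditional expectation. -/
def E : TriangularModel →ₗ[ℂ] ℂ[X] := extend Ew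

theorem Ew_nil : Ew [] = 1 := by
  have : nonCrossingInvolutions 0 = {1} := by
    ext σ; simp [mem_nonCrossing, Subsingleton.elim σ 1]
  simp [Ew, parse, Vsum, List.equivSigmaTuple, this, kappaSigma, evalSubword]

theorem E_left (a : TriangularModel) : E (xx * a) = Polynomial.X * E a := by
  have : E ∘ₗ LinearMap.mulLeft ℂ xx = LinearMap.mulLeft ℂ Polynomial.X ∘ₗ E := by
    refine model_ext fun w => ?_
    simp only [LinearMap.comp_apply, LinearMap.mulLeft_apply, xx, word_mul, E, extend_word,
      List.cons_append, List.nil_append, Ew, parse]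
    rcases parse w with ⟨_ | ⟨⟨p, s⟩, l⟩, k⟩
    · simp only [pow_succ]; ring
    · simp only [Vsum_left]; ring
  simpa using LinearMap.congr_fun this a

theorem E_right (a : TriangularModel) : E (a * xx) = E a * Polynomial.X := by
  have : E ∘ₗ LinearMap.mulRight ℂ xx = LinearMap.mulRight ℂ Polynomial.X ∘ₗ E := by
    refine model_ext fun w => ?_
    simp only [LinearMap.comp_apply, LinearMap.mulRight_apply, xx, word_mul, E, extend_word,
      Ew, parse_right, pow_succ, mul_assoc]
  simpa using LinearMap.congr_fun this a

theorem E_left' (b : ℂ[X]) : ∀ a : TriangularModel, E (incl b * a) = b * E a := by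
  induction b using poly_induction with
  | one => simp
  | add p q hp hq => intro a; simp [add_mul, hp, hq]
  | smul c p hp => intro a; simp [hp]
  | mulX p hp => intro a; rw [map_mul incl, incl_X, mul_assoc, hp, E_left, mul_assoc]

theorem E_right' (b : ℂ[X]) : ∀ a : TriangularModel, E (a * incl b) = E a * b := by
  induction b using poly_induction with
  | one => simp
  | add p q hp hq => intro a; simp [mul_add, hp, hq]
  | smul c p hp => intro a; simp [hp]
  | mulX p hp => intro a; rw [map_mul incl, incl_X, ← mul_assoc, E_right, hp, mul_assoc]

theorem E_one : E 1 = 1 := by rw [← word_nil, E, extend_word, Ew_nil]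

/-- The operator valued probability space. -/
def space : OpValuedProbSpace ℂ[X] TriangularModel where
  incl := incl
  incl_injective p q h := by
    have hp := E_right' p 1
    have hq := E_right' q 1
    rw [E_one, one_mul, one_mul] at hp hq
    rw [← hp, ← hq, h]
  E := E
  E_one := E_one
  E_bimod b₁ b₂ a := by rw [E_right', E_left']

theorem starPower_T (s) : starPower T s = word [some s] := by
  cases s
  · rfl
  · simp [starPower, T, star_word]

theorem incl_X_pow (k) : incl (Polynomial.X ^ k) = word (List.replicate k none) := by
  rw [map_pow, incl_X]
  induction k with
  | zero => rfl
  | succ k ih => rw [pow_succ', ih, xx, word_mul]; rfl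

theorem prod_word (l : List (ℕ × Bool)) : ∃ w, parse w = (l, 0) ∧
    (l.map fun z => incl (Polynomial.X ^ z.1) * starPower T z.2).prod = word w := by
  induction l with
  | nil => exact ⟨[], rfl, rfl⟩
  | cons z l ih =>
    obtain ⟨w, hw, hw'⟩ := ih
    refine ⟨List.replicate z.1 none ++ some z.2 :: w, ?_, ?_⟩
    · obtain ⟨k, s⟩ := z
      induction k with
      | zero => simp [parse, hw]
      | succ k ih =>
        simp only [List.replicate_succ, List.cons_append, parse] at ih ⊢
        rw [ih]
    · rw [List.map_cons, List.prod_cons, hw', incl_X_pow, starPower_T, word_mul, word_mul]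
      simp

theorem moment_monomial (m : ℕ) (f : Fin m → ℕ × Bool) :
    E (List.ofFn fun i => incl (Polynomial.X ^ (f i).1) * starPower T (f i).2).prod =
      Vsum ⟨m, f⟩ := by
  obtain ⟨w, hw, hw'⟩ := prod_word (List.ofFn f)
  rw [List.map_ofFn] at hw'
  change E (List.ofFn ((fun z : ℕ × Bool => incl (Polynomial.X ^ z.1) * starPower T z.2) ∘ f)).prod = _
  rw [hw', E, extend_word, Ew, hw]
  simp only [pow_zero, mul_one]
  congr 1
  exact List.equivSigmaTuple.right_inv ⟨m, f⟩

theorem moment (m : ℕ) (b : Fin m → ℂ[X]) (s : Fin m → Bool) :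
    E (List.ofFn fun i => incl (b i) * starPower T (s i)).prod =
      ∑ σ ∈ nonCrossingInvolutions m, kappaSigma incl kap σ fun i =>
        incl (b i) * starPower T (s i) := by
  let L : (i : Fin m) → ℂ[X] →ₗ[ℂ] TriangularModel := fun i =>
    LinearMap.mulRight ℂ (starPower T (s i)) ∘ₗ incl.toAlgHom.toLinearMap
  let F : MultilinearMap ℂ (fun _ : Fin m => ℂ[X]) ℂ[X] :=
    E.compMultilinearMap ((MultilinearMap.mkPiAlgebraFin ℂ m TriangularModel).compLinearMap L)
  let G : MultilinearMap ℂ (fun _ : Fin m => ℂ[X]) ℂ[X] :=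
    ∑ σ : {σ // σ ∈ nonCrossingInvolutions m},
      (kappaSigmaMultilinear incl kap σ.1 σ.2).compLinearMap L
  have hG : ∀ b, G b = ∑ σ ∈ nonCrossingInvolutions m, kappaSigma incl kap σ fun i =>
        incl (b i) * starPower T (s i) := by
    intro b
    rw [← Finset.sum_coe_sort]
    simp only [G, _root_.sum_apply, MultilinearMap.compLinearMap_apply]
    rfl
  have hF : ∀ b, F b = E (List.ofFn fun i => incl (b i) * starPower T (s i)).prod := by
    intro b
    simp only [F, LinearMap.compMultilinearMap_apply, MultilinearMap.compLinearMap_apply,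
      MultilinearMap.mkPiAlgebraFin_apply]
    rfl
  have : F = G := by
    refine Module.Basis.ext_multilinear (fun _ => Polynomial.basisMonomials ℂ) fun v => ?_
    rw [hF, hG]
    have := moment_monomial m fun i => (v i, s i)
    simpa [Polynomial.coe_basisMonomials, Polynomial.monomial_one_right_eq_X_pow, Vsum] using this
  rw [← hF, ← hG, this]

theorem kap_T (s s' : Bool) (b : ℂ[X]) :
    kap (starPower T s) (incl b * starPower T s') = K s s' b := by
  let F : ℂ[X] →ₗ[ℂ] ℂ[X] := kap (starPower T s) ∘ₗ
    LinearMap.mulRight ℂ (starPower T s') ∘ₗ incl.toAlgHom.toLinearMap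
  have : F = K s s' := by
    refine (Polynomial.basisMonomials ℂ).ext fun n => ?_
    have hp : parse (List.replicate n none ++ [some s']) = ([(n, s')], 0) := by
      induction n with
      | zero => rfl
      | succ n ih => simp only [List.replicate_succ, List.cons_append, parse, ih]
    have h : F (Polynomial.X ^ n) = K s s' (Polynomial.X ^ n) := by
      change kap (starPower T s) (incl (Polynomial.X ^ n) * starPower T s') = _
      rw [incl_X_pow, starPower_T, starPower_T, word_mul, kap_word, hp]
      simp [kap2, parse]
    simpa [Polynomial.coe_basisMonomials, Polynomial.monomial_one_right_eq_X_pow] using h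
  exact LinearMap.congr_fun this b

theorem nonCrossing_odd (n : ℕ) : nonCrossingInvolutions (2 * n + 1) = ∅ := by
  rw [Finset.eq_empty_iff_forall_notMem]
  intro σ hσ
  obtain ⟨h1, h2, -⟩ := mem_nonCrossing.1 hσ
  have := Finset.sum_involution (s := (Finset.univ : Finset (Fin (2 * n + 1))))
    (f := fun _ => (1 : ZMod 2)) (fun i _ => σ i) (fun i _ => by decide) (fun i _ _ => h2 i)
    (fun i _ => Finset.mem_univ _) (fun i _ => h1 i)
  simp at this
  have h : (2 : ZMod 2) = 0 := by decide
  simp [h] at this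

end TriangularModel

theorem exists_triangularOperator :
    ∃ (S : OpValuedProbSpace ℂ[X] TriangularModel) (T : TriangularModel), IsTriangularOperator S T := by
  refine ⟨TriangularModel.space, TriangularModel.T, TriangularModel.kap, ⟨TriangularModel.kap_bimodule, fun n b s => TriangularModel.moment _ b s,
    fun n b s => ?_⟩, fun b x _ => ?_, fun b x _ => ?_, fun b => ?_, fun b => ?_⟩
  · rw [TriangularModel.space, TriangularModel.moment, TriangularModel.nonCrossing_odd, Finset.sum_empty]
  · have := TriangularModel.kap_T false true b
    simp only [starPower] at this
    have h : (TriangularModel.kap TriangularModel.T (TriangularModel.incl b * star TriangularModel.T)) = TriangularModel.K false true b := this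
    change Polynomial.eval (x : ℂ) (TriangularModel.kap TriangularModel.T (TriangularModel.incl b * star TriangularModel.T)) = _
    rw [h]
    have h1 := TriangularModel.prim_eval b 1
    have hx := TriangularModel.prim_eval b x
    have hc : ∀ u v : ℝ, IntervalIntegrable (fun s : ℝ => b.eval (s : ℂ)) MeasureTheory.volume u v :=
      fun u v => (b.continuous.comp Complex.continuous_ofReal).intervalIntegrable _ _
    rw [← intervalIntegral.integral_interval_sub_left (hc 0 1) (hc 0 x), ← h1, ← hx]
    simp [TriangularModel.K, Polynomial.coe_aeval_eq_eval]
  · have h : (TriangularModel.kap (star TriangularModel.T) (TriangularModel.incl b * TriangularModel.T)) = TriangularModel.K true false b :=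
      TriangularModel.kap_T true false b
    change Polynomial.eval (x : ℂ) (TriangularModel.kap (star TriangularModel.T) (TriangularModel.incl b * TriangularModel.T)) = _
    rw [h, ← TriangularModel.prim_eval]; rfl
  · exact (TriangularModel.kap_T false false b).trans (by simp [TriangularModel.K])
  · exact (TriangularModel.kap_T true true b).trans (by simp [TriangularModel.K])

end TriangularModel
end

/-! The link between the three sides is `phiSum`, the sum of the iterated integrals over all plane
trees with n + 1 nodes.

From rooted to plane trees: for ψ(z) = 1/(1-z) the weight α(t) t! δ_t / |t|! is the number of plane
trees of shape t. Symmetry groups are avoided. Instead `IncreasingTree.sum_increasingTree` turns a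
sum over increasing trees into a weighted sum over plane forests, by induction on the number of
nodes: an increasing tree grows by attaching a leaf to any node. In the plane setting, a node with k
children offers k + 1 places for a new leaf while its factor k! becomes (k+1)!, so with weights 1/δ
the insertions amount to one growth per node (`sum_leafInsertions_div_orderings`). Read backwards,
insertions are deletions, and deleting leaves from a forest q satisfies ∑ 1/p! = |q|/q!
(`sum_leafDeletions_inv_forestFactorial`). Grouping by shape gives `RTree.series_geom`.

Integral system: a nonempty plane forest is a first tree followed by a forest, and φ is
multiplicative. Hence G = ∑ sⁿ `phiSum` aˣ aʸ n u satisfies G = 1 + X_u G, that is G = ψ(X_u)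
(`subst_pSeries_geom`), and likewise for Y. The coefficients of X_u of positive degree are the
integrals of those of ψ(Y_v) against aˣ(u,v), one degree lower, which is the system. The factor s
makes each coefficient a function of lower ones, whence uniqueness.

Moments: a noncrossing involution of the word TT*TT*⋯ splits at the partner of the first letter into
an inner word, which starts with the other letter, and a remaining word, which starts with the same
letter. This is the recursion of `phiSum`, with the kernels exchanged for the inner word, so
E((TT*)ⁿ) is `phiSum kernelY kernelX n` on [0,1] (`eval_subwordSum_alternating`). After integration,
the reflection v ↦ 1 - v exchanges the two kernels, and aʸ(0,·) = 1 on [0,1] identifies the result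
with a coefficient of Y_0. -/

namespace PlaneTree

/-! ### Forests -/

/-- The number of nodes of a forest. -/
def forestOrder (l : List PlaneTree) : ℕ := (l.map order).sum

@[simp] theorem forestOrder_nil : forestOrder [] = 0 := rfl

theorem order_node (l : List PlaneTree) : (node l).order = forestOrder l + 1 := by
  rw [order, forestOrder, add_comm]

@[simp] theorem forestOrder_cons (c r : List PlaneTree) :
    forestOrder (node c :: r) = forestOrder c + 1 + forestOrder r := by
  simp [forestOrder, order, add_comm]

/-- This is the coding of forests by binary trees: the children of the first root and the remaining
trees are both smaller forests, so the nested lists need no separate induction. -/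
theorem forest_induction {P : List PlaneTree → Prop} (nil : P [])
    (cons : ∀ c r, P c → P r → P (node c :: r)) : ∀ l, P l
  | [] => nil
  | node c :: r => cons c r (forest_induction nil cons c) (forest_induction nil cons r)

theorem forestOrder_eq_zero {l : List PlaneTree} : forestOrder l = 0 ↔ l = [] := by
  refine ⟨fun h => ?_, fun h => by simp [h]⟩
  rcases l with _ | ⟨⟨c⟩, r⟩
  · rfl
  · simp at h

/-- The finite set of the forests with `n` nodes. -/
noncomputable def forests (n : ℕ) : Finset (List PlaneTree) :=
  (show {l | forestOrder l = n}.Finite from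
    ((finite_order_eq (n + 1)).preimage (f := node)
      (fun _ _ _ _ h => by simpa using h)).subset fun l (hl : forestOrder l = n) => by
        simp [order_node, hl]).toFinset

@[simp] theorem mem_forests {n : ℕ} {l : List PlaneTree} : l ∈ forests n ↔ forestOrder l = n := by
  simp [forests]

@[simp] theorem mem_ofOrder {n : ℕ} {t : PlaneTree} : t ∈ ofOrder n ↔ t.order = n := by
  simp [ofOrder]

theorem forests_zero : forests 0 = {[]} := by
  ext l; simp [forestOrder_eq_zero]

theorem sum_ofOrder_succ {M : Type*} [AddCommMonoid M] (n : ℕ) (f : PlaneTree → M) :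
    ∑ t ∈ ofOrder (n + 1), f t = ∑ l ∈ forests n, f (node l) := by
  symm
  refine Finset.sum_bij (fun l _ => node l) (fun l hl => ?_) (fun _ _ _ _ h => by simpa using h)
    (fun t ht => ?_) (fun _ _ => rfl)
  · simpa [order_node] using hl
  · obtain ⟨l⟩ := t
    exact ⟨l, by simpa [order_node] using ht, rfl⟩

theorem ofOrder_zero : ofOrder 0 = ∅ := by
  ext t; simpa using t.order_pos.ne'

/-- Forests split into the children of the first root and the other trees. -/
theorem sum_forests_succ {M : Type*} [AddCommMonoid M] (n : ℕ) (f : List PlaneTree → M) :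
    ∑ l ∈ forests (n + 1), f l = ∑ x ∈ Finset.HasAntidiagonal.antidiagonal n,
      ∑ c ∈ forests x.1, ∑ r ∈ forests x.2, f (node c :: r) := by
  simp_rw [← Finset.sum_product']
  rw [Finset.sum_sigma']
  symm
  refine Finset.sum_bij (fun z _ => node z.2.1 :: z.2.2) (fun z hz => ?_) (fun z hz z' hz' h => ?_)
    (fun l hl => ?_) (fun _ _ => rfl)
  · simp at hz ⊢; omega
  · obtain ⟨⟨i, j⟩, c, r⟩ := z
    obtain ⟨⟨i', j'⟩, c', r'⟩ := z'
    simp at h hz hz'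
    obtain ⟨rfl, rfl⟩ := h
    obtain ⟨-, rfl, rfl⟩ := hz
    obtain ⟨-, rfl, rfl⟩ := hz'
    rfl
  · rcases l with _ | ⟨⟨c⟩, r⟩
    · simp at hl
    · refine ⟨⟨(forestOrder c, forestOrder r), c, r⟩, ?_, rfl⟩
      simp at hl ⊢; omega

/-! ### Insertion and deletion of leaves -/

/-- The forests obtained by the insertion of a leaf, at any position among the roots or among the
children of a node. -/
def leafInsertions : List PlaneTree → List (List PlaneTree)
  | [] => [[node []]]
  | node c :: r => (node [] :: node c :: r) ::
      ((leafInsertions c).map (fun q => node q :: r) ++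
        (leafInsertions r).map (fun q => node c :: q))

/-- The forests obtained by the deletion of a leaf. -/
def leafDeletions : List PlaneTree → List (List PlaneTree)
  | [] => []
  | node c :: r => (if c.isEmpty then [r] else []) ++
      ((leafDeletions c).map (fun q => node q :: r) ++
        (leafDeletions r).map (fun q => node c :: q))

/-- The forests obtained by giving one more child to one of the nodes. -/
def innerGrowths : List PlaneTree → List (List PlaneTree)
  | [] => []
  | node c :: r => (node (node [] :: c) :: r) ::
      ((innerGrowths c).map (fun q => node q :: r) ++
        (innerGrowths r).map (fun q => node c :: q))

/-- The forests obtained by giving one more child to one of the nodes, or to the common parent of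
the roots. -/
def growths (l : List PlaneTree) : List (List PlaneTree) := (node [] :: l) :: innerGrowths l

/-- Double counting of the pairs (p, q) where q is p with a marked extra leaf. The lists keep
multiplicities: a position in p corresponds to a leaf of q, even when several positions give the
same q. -/
theorem sum_leafInsertions (n : ℕ) (A : List PlaneTree → List PlaneTree → ℝ) :
    ∑ p ∈ forests n, ((leafInsertions p).map (A p)).sum =
      ∑ q ∈ forests (n + 1), ((leafDeletions q).map fun p => A p q).sum := by
  induction n using Nat.strong_induction_on generalizing A with
  | _ n ih =>
    rcases n with _ | n
    · rw [sum_forests_succ]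
      simp [forests_zero, leafInsertions, leafDeletions]
    · rw [sum_forests_succ, sum_forests_succ]
      simp only [leafInsertions, leafDeletions, List.map_cons, List.map_append, List.map_map,
        List.sum_cons, List.sum_append, Finset.sum_add_distrib, Function.comp_def]
      congr 1
      -- A leaf inserted in front is undone by deleting the first tree of q, which must be a leaf:
      -- only the term (0, n + 1) of the antidiagonal contributes.
      · rw [← sum_forests_succ n fun l => A l (node [] :: l), Finset.Nat.sum_antidiagonal_succ]
        simp only [forests_zero, Finset.sum_singleton, List.isEmpty_nil, if_true, List.map_cons,
          List.map_nil, List.sum_cons, List.sum_nil, add_zero]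
        rw [Finset.sum_eq_zero (s := Finset.HasAntidiagonal.antidiagonal n), add_zero]
        intro x hx
        refine Finset.sum_eq_zero fun c hc => Finset.sum_eq_zero fun r hr => ?_
        have : c ≠ [] := by
          rintro rfl
          simp at hc
        simp [this]
      · congr 1
        -- Insertion below the first root: the term with no children on the side of q has no
        -- deletion there, and the others match by induction with the remaining trees fixed.
        · rw [Finset.Nat.sum_antidiagonal_succ]
          simp only [forests_zero, Finset.sum_singleton, leafDeletions,
            List.map_nil, List.sum_nil, Finset.sum_const_zero, zero_add]
          refine Finset.sum_congr rfl fun x hx => ?_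
          rw [Finset.sum_comm]
          refine Eq.trans ?_ Finset.sum_comm
          refine Finset.sum_congr rfl fun r hr => ?_
          exact ih x.1 (by simp at hx; omega) fun c q => A (node c :: r) (node q :: r)
        · rw [Finset.Nat.sum_antidiagonal_succ']
          simp only [forests_zero, Finset.sum_singleton, leafDeletions,
            List.map_nil, List.sum_nil, Finset.sum_const_zero, zero_add]
          refine Finset.sum_congr rfl fun x hx => ?_
          refine Finset.sum_congr rfl fun r hr => ?_
          exact ih x.2 (by simp at hx; omega) fun c q => A (node r :: c) (node r :: q)

/-! ### The forest factorial -/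

/-- The product of the tree factorials. -/
def forestFactorial (l : List PlaneTree) : ℝ := (l.map fun t => (t.treeFactorial : ℝ)).prod

@[simp] theorem forestFactorial_nil : forestFactorial [] = 1 := rfl

theorem cast_prod_treeFactorial (l : List PlaneTree) :
    (((l.map fun t => treeFactorial t).prod : ℕ) : ℝ) = forestFactorial l := by
  induction l with
  | nil => simp
  | cons t l ih =>
    simp only [List.map_cons, List.prod_cons, Nat.cast_mul, ih, forestFactorial]

theorem cast_treeFactorial_node (l : List PlaneTree) :
    ((node l).treeFactorial : ℝ) = (forestOrder l + 1) * forestFactorial l := by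
  rw [treeFactorial, Nat.cast_mul, cast_prod_treeFactorial, order_node]
  push_cast; rfl

@[simp] theorem forestFactorial_cons (c r : List PlaneTree) :
    forestFactorial (node c :: r) =
      (forestOrder c + 1) * forestFactorial c * forestFactorial r := by
  rw [← cast_treeFactorial_node]; simp [forestFactorial]

theorem forestFactorial_pos (l : List PlaneTree) : 0 < forestFactorial l := by
  induction l using forest_induction with
  | nil => simp
  | cons c r hc hr => rw [forestFactorial_cons]; positivity

theorem forestOrder_of_mem_leafDeletions {q p : List PlaneTree} (h : p ∈ leafDeletions q) :
    forestOrder p + 1 = forestOrder q := by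
  induction q using forest_induction generalizing p with
  | nil => simp [leafDeletions] at h
  | cons c r hc hr =>
    simp only [leafDeletions, List.mem_append, List.mem_map] at h
    rcases h with h | ⟨a, ha, rfl⟩ | ⟨a, ha, rfl⟩
    · split_ifs at h with h0
      · simp at h h0; subst h h0; simp; omega
      · simp at h
    · have := hc ha; simp; omega
    · have := hr ha; simp; omega

/-- The recursion behind the hook length formula for forests. -/
theorem sum_leafDeletions_inv_forestFactorial (q : List PlaneTree) :
    ((leafDeletions q).map fun p => (forestFactorial p)⁻¹).sum =
      forestOrder q * (forestFactorial q)⁻¹ := by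
  induction q using forest_induction with
  | nil => simp [leafDeletions]
  | cons c r hc hr =>
    have h2 : ((leafDeletions c).map fun p => (forestFactorial (node p :: r))⁻¹).sum =
        ((leafDeletions c).map fun p => (forestFactorial p)⁻¹ *
          ((forestOrder c : ℝ) * forestFactorial r)⁻¹).sum := by
      congr 1
      refine List.map_congr_left fun p hp => ?_
      rw [← forestOrder_of_mem_leafDeletions hp, forestFactorial_cons]
      push_cast
      rw [← mul_inv]; congr 1; ring
    have h3 : ((leafDeletions r).map fun p => (forestFactorial (node c :: p))⁻¹).sum =
        ((leafDeletions r).map fun p => (forestFactorial p)⁻¹ *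
          (((forestOrder c : ℝ) + 1) * forestFactorial c)⁻¹).sum := by
      congr 1
      refine List.map_congr_left fun p hp => ?_
      rw [forestFactorial_cons, ← mul_inv]; congr 1; ring
    simp only [leafDeletions, List.map_append, List.sum_append, List.map_map, Function.comp_def]
    rw [h2, h3, List.sum_map_mul_right, List.sum_map_mul_right, hc, hr, forestFactorial_cons,
      forestOrder_cons]
    have pc := forestFactorial_pos c
    have pr := forestFactorial_pos r
    -- The contribution of the first tree is 1/(c! r!) in both cases. If c is empty it comes from
    -- deleting the root, and the deletions below vanish; otherwise |c|/c! cancels against the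
    -- factor |c| left in the new hook length.
    rcases c.eq_nil_or_concat' with rfl | hne
    · simp; field_simp
    · have hc0 : c ≠ [] := by obtain ⟨_, _, rfl⟩ := hne; simp
      have h0 : (forestOrder c : ℝ) ≠ 0 := by
        exact_mod_cast fun h => hc0 (forestOrder_eq_zero.1 h)
      simp [hc0]
      field_simp

/-! ### Invariance under isomorphism -/

/-- The roots are opened through the equations `s = node l`, `t = node l'`, so that the induction
passes through the arbitrary middle tree of `trans`. -/
theorem Iso.cons_children {s t : PlaneTree} (h : Iso s t) :
    ∀ (c : PlaneTree) (l l' : List PlaneTree), s = node l → t = node l' →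
      Iso (node (c :: l)) (node (c :: l')) := by
  induction h with
  | perm h => rintro c l l' h1 h2; cases h1; cases h2; exact Iso.perm (h.cons c)
  | replace a b h _ =>
    rintro c l l' h1 h2; cases h1; cases h2; exact Iso.replace (c :: a) b h
  | refl t => rintro c l l' h1 h2; cases h1; cases h2; exact Iso.refl _
  | symm _ ih => exact fun c l l' h1 h2 => (ih c l' l h2 h1).symm
  | @trans s t u _ _ ih₁ ih₂ =>
    intro c l l' h1 h2
    obtain ⟨m⟩ := t
    exact (ih₁ c l m h1 rfl).trans (ih₂ c m l' rfl h2)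

/-- `F` takes the same value on forests which are isomorphic, ignoring the order of the trees. -/
def IsoInvariant (F : List PlaneTree → ℝ) : Prop :=
  ∀ ⦃l l' : List PlaneTree⦄, Iso (node l) (node l') → F l = F l'

theorem IsoInvariant.cons {F : List PlaneTree → ℝ} (hF : IsoInvariant F) (t : PlaneTree) :
    IsoInvariant fun q => F (t :: q) :=
  fun l l' h => hF (h.cons_children t l l' rfl rfl)

theorem IsoInvariant.node_cons {F : List PlaneTree → ℝ} (hF : IsoInvariant F)
    (r : List PlaneTree) : IsoInvariant fun q => F (node q :: r) :=
  fun _ _ h => hF (Iso.replace [] r h)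

/-! ### The elementary differentials of `1/(1-z)` -/

theorem coeff_geom (n : ℕ) : PowerSeries.coeff n ((1 - PowerSeries.X)⁻¹ : ℝ⟦X⟧) = 1 := by
  have h : ((1 - PowerSeries.X)⁻¹ : ℝ⟦X⟧) = PowerSeries.mk 1 := by
    rw [PowerSeries.inv_eq_iff_mul_eq_one (by simp)]
    exact PowerSeries.mk_one_mul_one_sub_eq_one ℝ
  simp [h]

/-- The number `∏ k_v!` of orderings of the children of each of the nodes: `δ_t` for
`ψ(z) = 1/(1-z)`. -/
noncomputable def orderings (t : PlaneTree) : ℝ := elemDiff (1 - PowerSeries.X)⁻¹ t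

theorem orderings_node (l : List PlaneTree) :
    orderings (node l) = l.length ! * (l.map orderings).prod := by
  rw [orderings, elemDiff, coeff_geom, mul_one]; rfl

theorem prod_orderings_pos (l : List PlaneTree) : 0 < (l.map orderings).prod := by
  induction l using forest_induction with
  | nil => simp
  | cons c r hc hr => rw [List.map_cons, List.prod_cons, orderings_node]; positivity

theorem orderings_pos (t : PlaneTree) : 0 < orderings t := by
  obtain ⟨l⟩ := t
  rw [orderings_node]
  have := prod_orderings_pos l
  positivity

/-- The second identity is the goal: k + 1 equivalent positions at a node compensate the passage
from k! to (k+1)!. Its induction needs the first one, where the factorial at the top level is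
replaced by an arbitrary weight `w` of the number of roots, because removing the first tree shifts
that number. -/
theorem sum_leafInsertions_div_orderings (p : List PlaneTree) :
    ∀ (F : List PlaneTree → ℝ), IsoInvariant F →
    (∀ w : ℕ → ℝ, ((leafInsertions p).map fun q => F q / (q.map orderings).prod * w q.length).sum =
      (w (p.length + 1) * (p.length + 1) * F (node [] :: p) +
        w p.length * ((innerGrowths p).map F).sum) / (p.map orderings).prod) ∧
    ((leafInsertions p).map fun q => F q / orderings (node q)).sum =
      ((growths p).map F).sum / orderings (node p) := by
  have key : ∀ p : List PlaneTree, ∀ (F : List PlaneTree → ℝ),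
    (∀ w : ℕ → ℝ, ((leafInsertions p).map fun q => F q / (q.map orderings).prod * w q.length).sum =
      (w (p.length + 1) * (p.length + 1) * F (node [] :: p) +
        w p.length * ((innerGrowths p).map F).sum) / (p.map orderings).prod) →
    ((leafInsertions p).map fun q => F q / orderings (node q)).sum =
      ((growths p).map F).sum / orderings (node p) := by
    intro p F h
    -- This weight restores the factor of the root of `node q`.
    have h1 := h fun n => (n ! : ℝ)⁻¹
    have e : ∀ q : List PlaneTree, F q / orderings (node q) =
        F q / (q.map orderings).prod * (q.length ! : ℝ)⁻¹ := by
      intro q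
      rw [orderings_node, mul_comm, ← div_div]; rfl
    simp only [e]
    rw [h1, orderings_node, growths, List.map_cons, List.sum_cons]
    have := prod_orderings_pos p
    rw [Nat.factorial_succ]
    push_cast
    field_simp
  induction p using forest_induction with
  | nil =>
    intro F hF
    refine and_iff_left_of_imp (key _ F) |>.2 fun w => ?_
    simp [leafInsertions, innerGrowths, orderings_node]; ring
  | cons c r hc hr =>
    intro F hF
    refine and_iff_left_of_imp (key _ F) |>.2 fun w => ?_
    have h2 : ((leafInsertions c).map fun q => F (node q :: r) /
          ((node q :: r).map orderings).prod * w (node q :: r).length).sum =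
        ((leafInsertions c).map fun q => F (node q :: r) / orderings (node q) *
          (w (r.length + 1) / (r.map orderings).prod)).sum := by
      congr 1
      refine List.map_congr_left fun q _ => ?_
      rw [List.map_cons, List.prod_cons, List.length_cons, ← div_div]
      ring
    have h3 : ((leafInsertions r).map fun q => F (node c :: q) /
          ((node c :: q).map orderings).prod * w (node c :: q).length).sum =
        ((leafInsertions r).map fun q => (F (node c :: q) / (q.map orderings).prod *
          w (q.length + 1)) * (orderings (node c))⁻¹).sum := by
      congr 1
      refine List.map_congr_left fun q _ => ?_
      rw [List.map_cons, List.prod_cons, List.length_cons, mul_comm (orderings _), ← div_div]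
      ring
    -- By invariance, the leaf in front counts the same as the leaves inserted after the first tree,
    -- which completes the `p.length + 1` equal terms.
    have h4 : F (node [] :: node c :: r) = F (node c :: node [] :: r) :=
      hF (Iso.perm (List.Perm.swap _ _ _))
    simp only [leafInsertions, innerGrowths, List.map_append, List.map_cons, List.sum_cons,
      List.sum_append, List.map_map, Function.comp_def, List.length_cons]
    simp only [List.map_cons, List.length_cons] at h2 h3
    rw [h2, h3, List.sum_map_mul_right, List.sum_map_mul_right, (hc _ (hF.node_cons r)).2,
      (hr _ (hF.cons (node c))).1 fun n => w (n + 1), h4, growths]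
    have h5 : orderings (node []) = 1 := by simp [orderings_node]
    have p1 := prod_orderings_pos r
    have p2 := orderings_pos (node c)
    simp only [List.prod_cons, h5, List.map_cons, List.sum_cons]
    push_cast
    field_simp
    ring

/-- A leaf added at all the nodes in all the forests with `n` nodes. -/
theorem sum_growths (n : ℕ) (F : List PlaneTree → ℝ) (hF : IsoInvariant F) :
    ∑ p ∈ forests n, ((growths p).map F).sum / (forestFactorial p * orderings (node p)) =
      (n + 1) * ∑ q ∈ forests (n + 1), F q / (forestFactorial q * orderings (node q)) := by
  have h1 : ∀ p ∈ forests n,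
      ((growths p).map F).sum / (forestFactorial p * orderings (node p)) =
      ((leafInsertions p).map fun q => F q / orderings (node q) * (forestFactorial p)⁻¹).sum := by
    intro p _
    rw [List.sum_map_mul_right, (sum_leafInsertions_div_orderings p F hF).2, mul_comm, ← div_div]
    rfl
  -- The ordering weight depends on q only and the factorial on p only, so once q is fixed the
  -- deletion identity applies to the inner sum and yields the factor n + 1.
  rw [Finset.sum_congr rfl h1, sum_leafInsertions n fun p q =>
    F q / orderings (node q) * (forestFactorial p)⁻¹, Finset.mul_sum]
  refine Finset.sum_congr rfl fun q hq => ?_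
  rw [List.sum_map_mul_left, sum_leafDeletions_inv_forestFactorial, mem_forests.1 hq]
  push_cast
  rw [mul_comm (forestFactorial q), ← div_div]; ring

end PlaneTree

/-! ### Invariance of sums over growths under isomorphism -/

namespace PlaneTree

/-- The first tree is given up to the equation `c = node cs` so that the lemma also applies to
`subtree p w`, which is a `node` only propositionally. -/
theorem sum_growths_cons (F : List PlaneTree → ℝ) (c : PlaneTree) (r : List PlaneTree) (cs)
    (hc : c = node cs) :
    ((innerGrowths (c :: r)).map F).sum =
      ((growths cs).map fun q => F (node q :: r)).sum +
        ((innerGrowths r).map fun q => F (c :: q)).sum := by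
  subst hc
  simp [innerGrowths, growths, Function.comp_def, add_assoc]

theorem sum_innerGrowths_perm {l l' : List PlaneTree} (h : l.Perm l') :
    ∀ F : List PlaneTree → ℝ, IsoInvariant F →
      ((innerGrowths l).map F).sum = ((innerGrowths l').map F).sum := by
  induction h with
  | nil => exact fun _ _ => rfl
  | @cons c l l' h ih =>
    intro F hF
    obtain ⟨c⟩ := c
    rw [sum_growths_cons F _ _ c rfl, sum_growths_cons F _ _ c rfl, ih _ (hF.cons _)]
    congr 3
    funext q
    exact hF (Iso.perm (h.cons _))
  | swap a b l =>
    intro F hF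
    obtain ⟨a⟩ := a
    obtain ⟨b⟩ := b
    have h1 : ∀ s t q, F (s :: t :: q) = F (t :: s :: q) :=
      fun s t q => hF (Iso.perm (List.Perm.swap _ _ _))
    rw [sum_growths_cons F _ _ _ rfl, sum_growths_cons F _ _ _ rfl,
      sum_growths_cons _ _ _ _ rfl, sum_growths_cons _ _ _ _ rfl]
    have e1 : (fun q => F (node b :: node q :: l)) = fun q => F (node q :: node b :: l) :=
      funext fun q => h1 _ _ _
    have e2 : (fun q => F (node a :: node q :: l)) = fun q => F (node q :: node a :: l) :=
      funext fun q => h1 _ _ _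
    have e3 : (fun q => F (node a :: node b :: q)) = fun q => F (node b :: node a :: q) :=
      funext fun q => h1 _ _ _
    rw [e1, e2, e3]
    ring
  | trans _ _ ih₁ ih₂ => exact fun F hF => (ih₁ F hF).trans (ih₂ F hF)

theorem sum_innerGrowths_replace (a r : List PlaneTree) {l l' : List PlaneTree}
    (h : Iso (node l) (node l'))
    (ih : ∀ F : List PlaneTree → ℝ, IsoInvariant F →
      ((growths l).map F).sum = ((growths l').map F).sum) :
    ∀ F : List PlaneTree → ℝ, IsoInvariant F →
      ((innerGrowths (a ++ node l :: r)).map F).sum =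
        ((innerGrowths (a ++ node l' :: r)).map F).sum := by
  induction a with
  | nil =>
    intro F hF
    rw [List.nil_append, List.nil_append, sum_growths_cons F _ _ _ rfl,
      sum_growths_cons F _ _ _ rfl, ih _ (hF.node_cons r)]
    congr 3
    funext q
    exact hF (Iso.replace [] q h)
  | cons c a iha =>
    intro F hF
    obtain ⟨c⟩ := c
    rw [List.cons_append, List.cons_append, sum_growths_cons F _ _ _ rfl,
      sum_growths_cons F _ _ _ rfl, iha _ (hF.cons _)]
    congr 3
    funext q
    exact hF (Iso.replace (node q :: a) r h)

/-- A permutation or a replacement of subtrees carries the nodes of one tree to those of the other,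
and the grown trees remain isomorphic. The invariance of the sum lets the induction over increasing
trees be applied to it in place of `F`. -/
theorem Iso.sum_growths_eq {s t : PlaneTree} (h : Iso s t) :
    ∀ l l' : List PlaneTree, s = node l → t = node l' → ∀ F : List PlaneTree → ℝ,
      IsoInvariant F → ((growths l).map F).sum = ((growths l').map F).sum := by
  induction h with
  | perm h =>
    rintro l l' h1 h2 F hF
    cases h1; cases h2
    simp only [growths, List.map_cons, List.sum_cons]
    rw [sum_innerGrowths_perm h F hF, hF (Iso.perm (h.cons _))]
  | @replace a b s t h ih =>
    rintro l l' h1 h2 F hF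
    cases h1; cases h2
    obtain ⟨l⟩ := s
    obtain ⟨l'⟩ := t
    simp only [growths, List.map_cons, List.sum_cons]
    rw [sum_innerGrowths_replace a b h (ih l l' rfl rfl) F hF]
    congr 1
    exact hF (Iso.replace (node [] :: a) b h)
  | refl t => rintro l l' h1 h2; cases h1; cases h2; exact fun _ _ => rfl
  | symm _ ih => exact fun l l' h1 h2 F hF => (ih l' l h2 h1 F hF).symm
  | @trans s t u _ _ ih₁ ih₂ =>
    intro l l' h1 h2 F hF
    obtain ⟨m⟩ := t
    exact (ih₁ l m h1 rfl F hF).trans (ih₂ m l' rfl h2 F hF)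

theorem IsoInvariant.sum_growths {F : List PlaneTree → ℝ} (hF : IsoInvariant F) :
    IsoInvariant fun l => ((growths l).map F).sum :=
  fun l l' h => h.sum_growths_eq l l' rfl rfl F hF

end PlaneTree

/-! ### Increasing trees and the growth of a last leaf -/

namespace IncreasingTree

open PlaneTree

variable {m : ℕ}

/-- The children of the node `w`, the index `i` standing for the node `i + 1`. -/
def kids (p : IncreasingTree m) (w : ℕ) : List (Fin m) :=
  (List.finRange m).filter fun i => (p i).val = w

theorem le_of_mem_kids {p : IncreasingTree m} {w : ℕ} {i : Fin m} (h : i ∈ kids p w) :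
    w ≤ i.val := by
  simp only [kids, List.mem_filter, decide_eq_true_eq] at h
  have := (p i).isLt
  omega

theorem kids_eq_nil (p : IncreasingTree m) {w : ℕ} (h : m ≤ w) : kids p w = [] := by
  rw [List.eq_nil_iff_forall_not_mem]
  intro i hi
  have := le_of_mem_kids hi
  omega

/-- Induction from the leaves to the root. -/
theorem descend_induction (p : IncreasingTree m) {P : ℕ → Prop}
    (h : ∀ w, (∀ i ∈ kids p w, P (i.val + 1)) → P w) (w : ℕ) : P w := by
  induction hn : m - w using Nat.strong_induction_on generalizing w with
  | _ n ih =>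
    refine h w fun i hi => ih _ ?_ _ rfl
    have := le_of_mem_kids hi
    omega

/-- The subtrees at the children of the node `w`. -/
def branches (p : IncreasingTree m) (w : ℕ) : List PlaneTree :=
  (kids p w).map fun i => p.subtree (i.val + 1)

theorem subtree_eq (p : IncreasingTree m) (w : ℕ) : p.subtree w = node (branches p w) := by
  rw [subtree]
  congr 1
  exact List.attach_map_val (l := kids p w) (f := fun i => p.subtree (i.val + 1))

/-- The node `w` and its descendants. -/
def descendants (p : IncreasingTree m) (w : ℕ) : List ℕ :=
  w :: ((kids p w).attach.map fun i => descendants p (i.1.val + 1)).flatten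
termination_by m - w
decreasing_by
  have := le_of_mem_kids i.2
  omega

theorem descendants_eq (p : IncreasingTree m) (w : ℕ) :
    descendants p w = w :: (kids p w).flatMap fun i => descendants p (i.val + 1) := by
  rw [descendants, List.flatMap]
  congr 2
  exact List.attach_map_val (l := kids p w) (f := fun i => descendants p (i.val + 1))

theorem order_subtree (p : IncreasingTree m) (w : ℕ) :
    (p.subtree w).order = (descendants p w).length := by
  induction w using descend_induction p with
  | h w ih =>
    rw [subtree_eq, order_node, descendants_eq, List.length_cons, List.length_flatMap,
      forestOrder, branches, List.map_map]
    congr 2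
    exact List.map_congr_left ih

/-- A new leaf is attached to the node `v`. -/
def graft (p : IncreasingTree m) (v : ℕ) : IncreasingTree (m + 1) :=
  Fin.snoc (α := fun i : Fin (m + 1) => Fin (i.val + 1)) p (Fin.ofNat (m + 1) v)

theorem kids_graft (p : IncreasingTree m) {v : ℕ} (hv : v ≤ m) (w : ℕ) :
    kids (graft p v) w =
      (kids p w).map Fin.castSucc ++ if v = w then [Fin.last m] else [] := by
  have h1 : ∀ i : Fin m, (graft p v i.castSucc).val = (p i).val := fun i =>
    congrArg Fin.val (Fin.snoc_castSucc (α := fun i : Fin (m + 1) => Fin (i.val + 1)) _ p i)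
  have h2 : (graft p v (Fin.last m)).val = v := by
    have := congrArg Fin.val
      (Fin.snoc_last (α := fun i : Fin (m + 1) => Fin (i.val + 1)) (Fin.ofNat (m + 1) v) p)
    refine this.trans ?_
    simp [Fin.ofNat]; omega
  rw [kids, List.finRange_succ_last, List.filter_append, List.filter_map]
  congr 1
  · congr 1
    refine List.filter_congr fun i _ => ?_
    simp only [Function.comp_apply, h1]
  · simp only [List.filter_cons, h2, List.filter_nil, decide_eq_true_eq]

/-- The exception x = w is needed since `descendants p w` contains w even when w is not a node. -/
theorem count_descendants_eq_zero (p : IncreasingTree m) {x : ℕ} (hx : m < x) (w : ℕ)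
    (h : x ≠ w) : (descendants p w).count x = 0 := by
  induction w using descend_induction p with
  | h w ih =>
    rw [List.count_eq_zero, descendants_eq, List.mem_cons, List.mem_flatMap]
    rintro (h' | ⟨i, hi, hi'⟩)
    · exact h h'
    · exact List.count_eq_zero.1 (ih i hi (by omega)) hi'

/-- The new node m + 1 appears once for each occurrence of its parent v. Counting gives by induction
on m both that lists of descendants have no repetition and that the root has every node as a
descendant. -/
theorem count_descendants_graft (p : IncreasingTree m) {v : ℕ} (hv : v ≤ m) (x w : ℕ)
    (hw : w ≤ m) : (descendants (graft p v) w).count x =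
      (descendants p w).count x + (descendants p w).count v * if x = m + 1 then 1 else 0 := by
  induction w using descend_induction p with
  | h w ih =>
    rw [descendants_eq, descendants_eq p, kids_graft p hv, List.flatMap_append]
    have h1 : (List.map Fin.castSucc (kids p w)).flatMap
          (fun i => descendants (graft p v) (i.val + 1)) =
        (kids p w).flatMap fun i => descendants (graft p v) (i.val + 1) := by
      rw [List.flatMap_map]; rfl
    have h2 : ((if v = w then [Fin.last m] else []).flatMap
          (fun i => descendants (graft p v) (i.val + 1))) = if v = w then [m + 1] else [] := by
      split_ifs
      · rw [List.flatMap_singleton, descendants_eq, kids_eq_nil _ (by simp)]; simp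
      · rfl
    have h3 : ((kids p w).map fun i => (descendants (graft p v) (i.val + 1)).count x).sum =
        ((kids p w).map fun i => (descendants p (i.val + 1)).count x +
          (descendants p (i.val + 1)).count v * if x = m + 1 then 1 else 0).sum := by
      congr 1
      exact List.map_congr_left fun i hi => ih i hi i.isLt
    rw [h1, h2]
    simp only [List.count_cons, List.count_append, List.count_flatMap, Function.comp_def]
    rw [h3, List.sum_map_add, List.sum_map_mul_right, beq_eq_decide, beq_eq_decide]
    have h4 : List.count x (if v = w then [m + 1] else []) =
        (if v = w then 1 else 0) * if x = m + 1 then 1 else 0 := by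
      by_cases hvw : v = w <;> by_cases hx : x = m + 1 <;>
        simp [hvw, hx, eq_comm (a := m + 1)]
    rw [h4]
    simp only [decide_eq_true_eq, eq_comm (a := w) (b := v)]
    ring

theorem exists_graft (p : IncreasingTree (m + 1)) :
    ∃ (q : IncreasingTree m) (v : ℕ), v ≤ m ∧ p = graft q v := by
  refine ⟨fun i => p i.castSucc, (p (Fin.last m)).val, ?_, ?_⟩
  · have := (p (Fin.last m)).isLt
    simp only [Fin.val_last] at this
    omega
  · have h : Fin.ofNat (m + 1) (p (Fin.last m)).val = p (Fin.last m) := by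
      ext
      simpa [Fin.ofNat] using Nat.le_of_lt_succ (p (Fin.last m)).isLt
    rw [graft, h]
    exact (Fin.snoc_init_self (α := fun i : Fin (m + 1) => Fin (i.val + 1)) p).symm

theorem count_descendants_zero (p : IncreasingTree m) (x : ℕ) :
    (descendants p 0).count x = if x ≤ m then 1 else 0 := by
  induction m generalizing x with
  | zero =>
    rw [descendants_eq, kids_eq_nil _ le_rfl]
    by_cases hx : x = 0
    · simp [hx]
    · simp [hx, Ne.symm hx]
  | succ m ih =>
    obtain ⟨q, v, hv, rfl⟩ := exists_graft p
    rw [count_descendants_graft q hv x 0 (Nat.zero_le _), ih, ih, if_pos hv]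
    split_ifs <;> omega

theorem count_descendants_le_one (p : IncreasingTree m) (x w : ℕ) :
    (descendants p w).count x ≤ 1 := by
  induction m generalizing x with
  | zero =>
    rw [descendants_eq, kids_eq_nil _ (Nat.zero_le _)]
    simp only [List.flatMap_nil, List.count_cons, List.count_nil]
    split_ifs <;> omega
  | succ m ih =>
    obtain ⟨q, v, hv, rfl⟩ := exists_graft p
    rcases Nat.lt_or_ge m w with hw | hw
    · rw [descendants_eq, kids_eq_nil _ hw]
      simp only [List.flatMap_nil, List.count_cons, List.count_nil]
      split_ifs <;> omega
    · rw [count_descendants_graft q hv x w hw]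
      split_ifs with hx
      · rw [count_descendants_eq_zero q (by omega) w (by omega)]
        simpa using ih q v
      · simpa using ih q x

theorem nodup_descendants (p : IncreasingTree m) (w : ℕ) : (descendants p w).Nodup :=
  List.nodup_iff_count_le_one.2 fun x => count_descendants_le_one p x w

theorem descendants_zero_perm (p : IncreasingTree m) :
    (descendants p 0).Perm (List.range (m + 1)) := by
  refine List.perm_iff_count.2 fun x => ?_
  rw [count_descendants_zero, List.count_range]
  simp only [Nat.lt_succ_iff]

theorem branches_graft (p : IncreasingTree m) {v : ℕ} (hv : v ≤ m) (w : ℕ) :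
    branches (graft p v) w = ((kids p w).map fun i => (graft p v).subtree (i.val + 1)) ++
      if v = w then [node []] else [] := by
  rw [branches, kids_graft p hv, List.map_append, List.map_map]
  congr 1
  split_ifs
  · rw [List.map_singleton, subtree_eq, branches, kids_eq_nil _ (by simp)]; rfl
  · rfl

theorem subtree_graft_of_notMem (p : IncreasingTree m) {v : ℕ} (hv : v ≤ m) {w : ℕ}
    (h : v ∉ descendants p w) : (graft p v).subtree w = p.subtree w := by
  induction w using descend_induction p with
  | h w ih =>
    rw [descendants_eq, List.mem_cons, List.mem_flatMap] at h
    push Not at h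
    rw [subtree_eq, subtree_eq, branches_graft p hv w, if_neg h.1, List.append_nil, branches]
    congr 1
    exact List.map_congr_left fun i hi => ih i hi (h.2 i hi)

/-- Since the lists of descendants are disjoint, a leaf grafted at v changes exactly one tree of the
forest, as an inner growth does. -/
theorem sum_branches_graft_forest (p : IncreasingTree m) (cs : List (Fin m))
    (hp : ∀ x ∈ cs.flatMap fun i => descendants p (i.val + 1), x ≤ m)
    (ih : ∀ i ∈ cs, ∀ F : List PlaneTree → ℝ, IsoInvariant F →
      ((descendants p (i.val + 1)).map fun v => F (branches (graft p v) (i.val + 1))).sum =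
        ((growths (branches p (i.val + 1))).map F).sum)
    (hn : (cs.flatMap fun i => descendants p (i.val + 1)).Nodup) :
    ∀ F : List PlaneTree → ℝ, IsoInvariant F →
      ((cs.flatMap fun i => descendants p (i.val + 1)).map fun v =>
        F (cs.map fun i => (graft p v).subtree (i.val + 1))).sum =
      ((innerGrowths (cs.map fun i => p.subtree (i.val + 1))).map F).sum := by
  induction cs with
  | nil => intro F hF; simp [innerGrowths]
  | cons c cs ihc =>
    intro F hF
    rw [List.flatMap_cons] at hn hp ⊢
    obtain ⟨-, hn2, hn3⟩ := List.nodup_append.1 hn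
    rw [List.map_append, List.sum_append, List.map_cons,
      sum_growths_cons F _ _ _ (subtree_eq p (c.val + 1)),
      ← ih c (by simp) _ (hF.node_cons _),
      ← ihc (fun x hx => hp x (List.mem_append_right _ hx))
        (fun i hi => ih i (by simp [hi])) hn2 _ (hF.cons _)]
    congr 2
    · refine List.map_congr_left fun v hv => ?_
      rw [List.map_cons, subtree_eq (graft p v) (c.val + 1)]
      congr 2
      refine List.map_congr_left fun i hi => ?_
      refine subtree_graft_of_notMem p (hp v (List.mem_append_left _ hv))
        fun h => hn3 v hv v (List.mem_flatMap.2 ⟨i, hi, h⟩) rfl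
    · refine List.map_congr_left fun v hv => ?_
      rw [List.map_cons, subtree_graft_of_notMem p
        (hp v (List.mem_append_right _ hv))
        fun h => hn3 v h v hv rfl]

theorem le_of_mem_descendants {p : IncreasingTree m} {w x : ℕ} (hw : w ≤ m)
    (h : x ∈ descendants p w) : x ≤ m := by
  by_contra hx
  exact List.count_eq_zero.1 (count_descendants_eq_zero p (by omega) w (by omega)) h

theorem sum_branches_graft (p : IncreasingTree m) (w : ℕ) (hw : w ≤ m) :
    ∀ F : List PlaneTree → ℝ, IsoInvariant F →
      ((descendants p w).map fun v => F (branches (graft p v) w)).sum =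
        ((growths (branches p w)).map F).sum := by
  induction w using descend_induction p with
  | h w ih =>
    intro F hF
    have hn := nodup_descendants p w
    have hle := fun x => le_of_mem_descendants (x := x) hw (p := p)
    rw [descendants_eq] at hn hle ⊢
    obtain ⟨hn1, hn2⟩ := List.nodup_cons.1 hn
    rw [List.map_cons, List.sum_cons, growths, List.map_cons, List.sum_cons, branches.eq_def p w,
      ← sum_branches_graft_forest p (kids p w) (fun x hx => hle x (List.mem_cons_of_mem _ hx))
        (fun i hi => ih i hi i.isLt) hn2 F hF]
    congr 1
    · rw [branches_graft p hw w, if_pos rfl]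
      have : (kids p w).map (fun i => (graft p w).subtree (i.val + 1)) =
          (kids p w).map fun i => p.subtree (i.val + 1) :=
        List.map_congr_left fun i hi => subtree_graft_of_notMem p hw
          fun h => hn1 (List.mem_flatMap.2 ⟨i, hi, h⟩)
      rw [this]
      -- The grafted leaf has the largest label and comes last among the children, whereas `growths`
      -- puts it first.
      exact hF (Iso.perm List.perm_append_comm)
    · congr 1
      refine List.map_congr_left fun v hv => ?_
      rw [branches_graft p (hle v (List.mem_cons_of_mem _ hv)) w, if_neg, List.append_nil]
      rintro rfl
      exact hn1 hv

/-- The sum over the increasing trees is a weighted sum over the plane trees. -/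
theorem sum_increasingTree (m : ℕ) : ∀ F : List PlaneTree → ℝ, IsoInvariant F →
    ∑ p : IncreasingTree m, F (branches p 0) =
      m ! * ∑ q ∈ forests m, F q / (forestFactorial q * orderings (node q)) := by
  induction m with
  | zero =>
    intro F hF
    rw [Fintype.sum_unique]
    simp [branches, kids_eq_nil, forests_zero, orderings_node]
  | succ m ih =>
    intro F hF
    have h1 : ∑ p : IncreasingTree (m + 1), F (branches p 0) =
        ∑ p : IncreasingTree m, ∑ v : Fin (m + 1), F (branches (graft p v) 0) := by
      rw [← (Fin.snocEquiv fun i : Fin (m + 1) => Fin (i.val + 1)).sum_comp,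
        Fintype.sum_prod_type_right]
      refine Finset.sum_congr rfl fun p _ => Finset.sum_congr rfl fun v _ => ?_
      have : graft p v.val = Fin.snocEquiv (fun i : Fin (m + 1) => Fin (i.val + 1)) (v, p) := by
        rw [graft]
        have h : Fin.ofNat (m + 1) v.val = v := by
          ext
          simpa [Fin.ofNat] using Nat.le_of_lt_succ v.isLt
        rw [h]; rfl
      rw [this]
    have h2 : ∀ p : IncreasingTree m, ∑ v : Fin (m + 1), F (branches (graft p v) 0) =
        ((growths (branches p 0)).map F).sum := by
      intro p
      rw [← sum_branches_graft p 0 (Nat.zero_le _) F hF,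
        ((descendants_zero_perm p).map _).sum_eq, ← Finset.sum_range fun v =>
          F (branches (graft p v) 0)]
      simp [Finset.sum, Finset.range, Multiset.range]
    -- The induction hypothesis is used for the function l ↦ ∑ F over the growths of l, and
    -- `sum_growths` returns to F with the factor m + 1.
    rw [h1, Finset.sum_congr rfl fun p _ => h2 p, ih _ hF.sum_growths, sum_growths m F hF,
      Nat.factorial_succ]
    push_cast
    ring

/-- This places the shapes in `RTree.ofOrder (m + 1)`, so that sums over trees can be regrouped by
fibres of `shape`. -/
theorem order_shape (p : IncreasingTree m) : p.shape.order = m + 1 := by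
  change (p.subtree 0).order = m + 1
  rw [order_subtree, (descendants_zero_perm p).length_eq, List.length_range]

end IncreasingTree

/-! ### From rooted trees to plane trees -/

namespace RTree

open PlaneTree

/-- The type in the definition of `alpha` depends on t; here all trees with m + 1 nodes share one
type of labelled trees. -/
theorem alpha_eq {t : RTree} {m : ℕ} (h : t.order = m + 1) :
    t.alpha = Nat.card {p : IncreasingTree m // p.shape = t} := by
  obtain rfl : m = t.order - 1 := by omega
  rfl

@[simp] theorem mem_ofOrder {n : ℕ} {t : RTree} : t ∈ ofOrder n ↔ t.order = n := by
  simp [ofOrder]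

/-- For `ψ(z) = 1/(1-z)`, the weights count the plane trees of a given shape. -/
theorem series_geom (f : RTree → ℝ) : series (1 - PowerSeries.X)⁻¹ f =
    PowerSeries.mk fun n => ∑ t ∈ PlaneTree.ofOrder n, f (Quotient.mk PlaneTree.isoSetoid t) := by
  classical
  rw [series]
  congr 1
  funext n
  rcases n with _ | m
  · rw [PlaneTree.ofOrder_zero, Finset.sum_empty]
    refine Finset.sum_eq_zero fun t ht => ?_
    induction t using Quotient.inductionOn with
    | h t => exact absurd (mem_ofOrder.1 ht) t.order_pos.ne'
  let g : RTree → ℝ := fun t =>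
    (t.treeFactorial : ℝ) * t.elemDiff (1 - PowerSeries.X)⁻¹ / ((m + 1) ! : ℝ) * f t
  have h1 : ∀ t ∈ ofOrder (m + 1), (t.alpha : ℝ) * (t.treeFactorial : ℝ) *
      t.elemDiff (1 - PowerSeries.X)⁻¹ / ((m + 1) ! : ℝ) * f t =
      ∑ p : IncreasingTree m with p.shape = t, g p.shape := by
    intro t ht
    rw [alpha_eq (mem_ofOrder.1 ht), Finset.sum_congr rfl (g := fun _ => g t)
      (fun p hp => by rw [(Finset.mem_filter.1 hp).2]), Finset.sum_const, nsmul_eq_mul,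
      Nat.card_eq_fintype_card, Fintype.card_subtype]
    simp only [g]
    ring
  -- The factor α(t) is the size of a fibre of `shape`, so the sum over t becomes a sum over all
  -- increasing trees.
  rw [Finset.sum_congr rfl h1, Finset.sum_fiberwise_of_maps_to
    (fun p _ => mem_ofOrder.2 p.order_shape)]
  let F : List PlaneTree → ℝ := fun l => g (Quotient.mk PlaneTree.isoSetoid (node l))
  have hF : IsoInvariant F := fun l l' h => congrArg g (Quotient.sound h)
  have h2 : ∀ p : IncreasingTree m, g p.shape = F (p.branches 0) := by
    intro p
    rw [IncreasingTree.shape, IncreasingTree.subtree_eq]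
  rw [Finset.sum_congr rfl fun p _ => h2 p, IncreasingTree.sum_increasingTree m F hF,
    sum_ofOrder_succ, Finset.mul_sum]
  refine Finset.sum_congr rfl fun q hq => ?_
  have h3 : F q = ((node q).treeFactorial : ℝ) * orderings (node q) / ((m + 1) ! : ℝ) *
    f (Quotient.mk PlaneTree.isoSetoid (node q)) := rfl
  have p1 := forestFactorial_pos q
  have p2 := orderings_pos (node q)
  -- The factors t! and δ_t in F cancel the weights 1/(q! δ), leaving m! (m + 1)/(m + 1)! = 1.
  rw [h3, cast_treeFactorial_node, mem_forests.1 hq, Nat.factorial_succ]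
  push_cast
  field_simp

end RTree

/-! ### Integration against the kernels -/

theorem integral_kernelX {u : ℝ} (hu : u ∈ Set.Icc (0 : ℝ) 1) (g : ℝ → ℝ) :
    ∫ v in (0 : ℝ)..1, kernelX u v * g v = ∫ v in (0 : ℝ)..u, g v := by
  rw [intervalIntegral.integral_of_le zero_le_one, intervalIntegral.integral_of_le hu.1,
    ← MeasureTheory.integral_indicator measurableSet_Ioc,
    ← MeasureTheory.integral_indicator measurableSet_Ioc]
  congr 1
  funext v
  simp only [kernelX, Set.indicator_apply, Set.mem_Ioc, Set.mem_Icc, Pi.one_apply]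
  have := hu.2
  split_ifs <;> first | (simp; done) | grind

/-- At v = u both closed intervals contain v; this null set does not affect the integrals. -/
theorem kernelX_add_kernelY {u v : ℝ} (hu : v ≠ u) (hv : v ∈ Set.Ioc (0 : ℝ) 1) :
    kernelY u v = 1 - kernelX u v := by
  simp only [kernelX, kernelY, Set.indicator_apply, Set.mem_Icc, Pi.one_apply]
  obtain ⟨h1, h2⟩ := hv
  rcases lt_or_gt_of_ne hu with h | h
  · rw [if_neg (by grind), if_pos (by grind)]; simp
  · rw [if_pos (by grind), if_neg (by grind)]; simp

theorem intervalIntegrable_kernelX (u : ℝ) {g : ℝ → ℝ} (hg : Continuous g) :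
    IntervalIntegrable (fun v => kernelX u v * g v) MeasureTheory.volume 0 1 := by
  have h : (fun v => kernelX u v * g v) = (Set.Icc 0 u).indicator g := by
    funext v; simp [kernelX, Set.indicator_apply]
  have hi := hg.intervalIntegrable (μ := MeasureTheory.volume) 0 1
  rw [h]
  exact ⟨hi.1.indicator measurableSet_Icc, hi.2.indicator measurableSet_Icc⟩

theorem intervalIntegrable_kernelY (u : ℝ) {g : ℝ → ℝ} (hg : Continuous g) :
    IntervalIntegrable (fun v => kernelY u v * g v) MeasureTheory.volume 0 1 := by
  have h : (fun v => kernelY u v * g v) = (Set.Icc u 1).indicator g := by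
    funext v; simp [kernelY, Set.indicator_apply]
  have hi := hg.intervalIntegrable (μ := MeasureTheory.volume) 0 1
  rw [h]
  exact ⟨hi.1.indicator measurableSet_Icc, hi.2.indicator measurableSet_Icc⟩

theorem integral_kernelY_eq_sub (u : ℝ) {g : ℝ → ℝ} (hg : Continuous g) :
    ∫ v in (0 : ℝ)..1, kernelY u v * g v =
      (∫ v in (0 : ℝ)..1, g v) - ∫ v in (0 : ℝ)..1, kernelX u v * g v := by
  rw [← intervalIntegral.integral_sub (hg.intervalIntegrable _ _) (intervalIntegrable_kernelX u hg)]
  refine intervalIntegral.integral_congr_ae ?_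
  have : ∀ᵐ v : ℝ, v ≠ u := by
    simp [MeasureTheory.ae_iff]
  filter_upwards [this] with v hv h
  rw [Set.uIoc_of_le zero_le_one] at h
  rw [kernelX_add_kernelY hv h]; ring

theorem integral_kernelY {u : ℝ} (hu : u ∈ Set.Icc (0 : ℝ) 1) {g : ℝ → ℝ} (hg : Continuous g) :
    ∫ v in (0 : ℝ)..1, kernelY u v * g v = ∫ v in u..1, g v := by
  rw [integral_kernelY_eq_sub u hg, integral_kernelX hu,
    intervalIntegral.integral_interval_sub_left (hg.intervalIntegrable _ _)
      (hg.intervalIntegrable _ _)]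

theorem continuous_integral_kernelX {g : ℝ → ℝ} (hg : Continuous g) :
    Continuous fun u => ∫ v in (0 : ℝ)..1, kernelX u v * g v := by
  have h : (fun u => ∫ v in (0 : ℝ)..1, kernelX u v * g v) =
      -- The kernel is used for all real u, but on (0,1] it only depends on u clamped to [0,1].
      fun u => ∫ v in (0 : ℝ)..max 0 (min 1 u), g v := by
    funext u
    rw [← integral_kernelX ⟨le_max_left _ _, max_le zero_le_one (min_le_left _ _)⟩]
    refine intervalIntegral.integral_congr_ae (.of_forall fun v hv => ?_)
    rw [Set.uIoc_of_le zero_le_one] at hv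
    obtain ⟨h1, h2⟩ := hv
    congr 1
    simp only [kernelX, Set.indicator_apply, Set.mem_Icc, Pi.one_apply, le_max_iff, le_min_iff]
    congr 1
    grind
  rw [h]
  exact (intervalIntegral.continuous_primitive (fun a b => hg.intervalIntegrable a b) 0).comp
    (by fun_prop)

theorem continuous_integral_kernelY {g : ℝ → ℝ} (hg : Continuous g) :
    Continuous fun u => ∫ v in (0 : ℝ)..1, kernelY u v * g v := by
  simp_rw [integral_kernelY_eq_sub _ hg]
  exact continuous_const.sub (continuous_integral_kernelX hg)

/-- Integration of a continuous function against the kernel makes sense and gives a continuous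
function. -/
structure IsContinuousKernel (a : ℝ → ℝ → ℝ) : Prop where
  intervalIntegrable : ∀ (u : ℝ) {g : ℝ → ℝ}, Continuous g →
    IntervalIntegrable (fun v => a u v * g v) MeasureTheory.volume 0 1
  continuous : ∀ {g : ℝ → ℝ}, Continuous g → Continuous fun u => ∫ v in (0 : ℝ)..1, a u v * g v

theorem isContinuousKernel_kernelX : IsContinuousKernel kernelX :=
  ⟨fun u _ => intervalIntegrable_kernelX u, continuous_integral_kernelX⟩

theorem isContinuousKernel_kernelY : IsContinuousKernel kernelY :=
  ⟨fun u _ => intervalIntegrable_kernelY u, continuous_integral_kernelY⟩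

/-! ### The iterated integrals -/

namespace PlaneTree

theorem phi_nil (a b : ℝ → ℝ → ℝ) (u : ℝ) : phi a b (node []) u = 1 := by
  simp [phi]

theorem phi_cons (a b : ℝ → ℝ → ℝ) (t : PlaneTree) (r : List PlaneTree) (u : ℝ) :
    phi a b (node (t :: r)) u =
      (∫ v in (0 : ℝ)..1, a u v * phi b a t v) * phi a b (node r) u := by
  simp [phi]

theorem continuous_phi_node (l : List PlaneTree) : ∀ {a b : ℝ → ℝ → ℝ}, IsContinuousKernel a →
    IsContinuousKernel b → Continuous (phi a b (node l)) := by
  induction l using forest_induction with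
  | nil =>
    intro a b _ _
    rw [show phi a b (node []) = fun _ => 1 from funext (phi_nil a b)]
    exact continuous_const
  | cons c r hc hr =>
    intro a b ha hb
    rw [show phi a b (node (node c :: r)) = _ from funext (phi_cons a b (node c) r)]
    exact (ha.continuous (hc hb ha)).mul (hr ha hb)

/-- The sum of the iterated integrals of the plane trees with `n + 1` nodes. -/
noncomputable def phiSum (a b : ℝ → ℝ → ℝ) (n : ℕ) (u : ℝ) : ℝ :=
  ∑ l ∈ forests n, phi a b (node l) u

theorem continuous_phiSum {a b : ℝ → ℝ → ℝ} (ha : IsContinuousKernel a)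
    (hb : IsContinuousKernel b) (n : ℕ) : Continuous (phiSum a b n) :=
  continuous_finsetSum _ fun l _ => continuous_phi_node l ha hb

theorem sum_integral_phi {a b c : ℝ → ℝ → ℝ} (ha : IsContinuousKernel a)
    (hb : IsContinuousKernel b) (hc : IsContinuousKernel c) (n : ℕ) (u : ℝ) :
    ∑ l ∈ forests n, ∫ v in (0 : ℝ)..1, a u v * phi b c (node l) v =
      ∫ v in (0 : ℝ)..1, a u v * phiSum b c n v := by
  rw [← intervalIntegral.integral_finsetSum fun l _ =>
    ha.intervalIntegrable u (continuous_phi_node l hb hc)]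
  simp only [phiSum, Finset.mul_sum]

theorem phiSum_zero (a b : ℝ → ℝ → ℝ) (u : ℝ) : phiSum a b 0 u = 1 := by
  rw [phiSum, forests_zero, Finset.sum_singleton, phi_nil]

/-- Catalan recursion by the first subtree at the root: it lies one level deeper, which exchanges
the kernels, while the other subtrees keep the same root. -/
theorem phiSum_succ {a b : ℝ → ℝ → ℝ} (ha : IsContinuousKernel a) (hb : IsContinuousKernel b)
    (n : ℕ) (u : ℝ) : phiSum a b (n + 1) u =
      ∑ x ∈ Finset.HasAntidiagonal.antidiagonal n,
        (∫ v in (0 : ℝ)..1, a u v * phiSum b a x.1 v) * phiSum a b x.2 u := by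
  rw [phiSum, sum_forests_succ]
  refine Finset.sum_congr rfl fun x _ => ?_
  rw [← sum_integral_phi ha hb ha, phiSum, Finset.sum_mul_sum]
  refine Finset.sum_congr rfl fun c _ => Finset.sum_congr rfl fun r _ => ?_
  rw [phi_cons]

end PlaneTree

open PlaneTree

/-! ### The P-series -/

theorem pSeries_geom (a b : ℝ → ℝ → ℝ) (u : ℝ) : pSeries (1 - PowerSeries.X)⁻¹ a b 0 u =
    PowerSeries.mk fun n => ∑ t ∈ PlaneTree.ofOrder n,
      ∫ v in (0 : ℝ)..1, a u v * PlaneTree.phi b a t v := by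
  rw [pSeries, RTree.series_geom, map_zero, zero_add]
  rfl

theorem constantCoeff_pSeries_geom (a b : ℝ → ℝ → ℝ) (u : ℝ) :
    PowerSeries.constantCoeff (pSeries (1 - PowerSeries.X)⁻¹ a b 0 u) = 0 := by
  rw [pSeries_geom, ← PowerSeries.coeff_zero_eq_constantCoeff_apply, PowerSeries.coeff_mk,
    ofOrder_zero, Finset.sum_empty]

theorem coeff_succ_pSeries_geom {a b : ℝ → ℝ → ℝ} (ha : IsContinuousKernel a)
    (hb : IsContinuousKernel b) (n : ℕ) (u : ℝ) :
    PowerSeries.coeff (n + 1) (pSeries (1 - PowerSeries.X)⁻¹ a b 0 u) =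
      ∫ v in (0 : ℝ)..1, a u v * phiSum b a n v := by
  rw [pSeries_geom, PowerSeries.coeff_mk, sum_ofOrder_succ, sum_integral_phi ha hb ha]

theorem subst_geom {W : ℝ⟦X⟧} (hW : PowerSeries.constantCoeff W = 0) :
    (PowerSeries.subst W ((1 - PowerSeries.X)⁻¹ : ℝ⟦X⟧) : ℝ⟦X⟧) * (1 - W) = 1 := by
  have hs : PowerSeries.HasSubst W := PowerSeries.HasSubst.of_constantCoeff_zero' hW
  have h : ((1 - PowerSeries.X)⁻¹ : ℝ⟦X⟧) * (1 - PowerSeries.X) = 1 :=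
    PowerSeries.inv_mul_cancel _ (by simp)
  have h1 := congrArg (PowerSeries.substAlgHom (R := ℝ) hs) h
  rw [map_mul, map_sub, map_one, PowerSeries.substAlgHom_X, PowerSeries.coe_substAlgHom] at h1
  exact h1

theorem subst_geom_eq_inv {W : ℝ⟦X⟧} (hW : PowerSeries.constantCoeff W = 0) :
    (PowerSeries.subst W ((1 - PowerSeries.X)⁻¹ : ℝ⟦X⟧) : ℝ⟦X⟧) = (1 - W)⁻¹ :=
  (PowerSeries.eq_inv_iff_mul_eq_one (by simp [hW])).2 (subst_geom hW)

/-- The recursion `phiSum_succ` says that the right-hand side G satisfies G = 1 + Z G, where Z is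
the P-series, so G is the inverse of 1 - Z. -/
theorem subst_pSeries_geom {a b : ℝ → ℝ → ℝ} (ha : IsContinuousKernel a)
    (hb : IsContinuousKernel b) (u : ℝ) :
    (PowerSeries.subst (pSeries (1 - PowerSeries.X)⁻¹ a b 0 u) ((1 - PowerSeries.X)⁻¹ : ℝ⟦X⟧) : ℝ⟦X⟧) =
      PowerSeries.mk fun n => phiSum a b n u := by
  have h0 := constantCoeff_pSeries_geom a b u
  rw [subst_geom_eq_inv h0, eq_comm, PowerSeries.eq_inv_iff_mul_eq_one (by simp [h0]), mul_sub,
    mul_one, sub_eq_iff_eq_add, mul_comm]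
  ext n
  rw [PowerSeries.coeff_mk, map_add, PowerSeries.coeff_mul]
  rcases n with _ | n
  · simp [h0, phiSum_zero]
  · rw [Finset.Nat.sum_antidiagonal_succ]
    simp [h0, PowerSeries.coeff_one, coeff_succ_pSeries_geom ha hb, phiSum_succ ha hb]

theorem solvesIntegralEq_pSeries_geom {a b : ℝ → ℝ → ℝ} (ha : IsContinuousKernel a)
    (hb : IsContinuousKernel b) : SolvesIntegralEq (1 - PowerSeries.X)⁻¹ a 0
      (pSeries (1 - PowerSeries.X)⁻¹ a b 0) (pSeries (1 - PowerSeries.X)⁻¹ b a 0) := by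
  intro u _
  simp only [subst_pSeries_geom hb ha, PowerSeries.coeff_mk]
  refine ⟨fun n => ha.intervalIntegrable u (continuous_phiSum hb ha n), ?_⟩
  ext n
  rcases n with _ | n
  · simp [constantCoeff_pSeries_geom]
  · rw [coeff_succ_pSeries_geom ha hb]
    simp [PowerSeries.coeff_succ_X_mul]

/-! ### Uniqueness -/

theorem constantCoeff_of_solvesIntegralEq {ψ : ℝ⟦X⟧} {a : ℝ → ℝ → ℝ} {c : ℝ} {Z W : ℝ → ℝ⟦X⟧}
    (h : SolvesIntegralEq ψ a c Z W) {u : ℝ} (hu : u ∈ Set.Icc (0 : ℝ) 1) :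
    PowerSeries.constantCoeff (Z u) = c := by
  rw [(h u hu).2]; simp

theorem coeff_succ_of_solvesIntegralEq {ψ : ℝ⟦X⟧} {a : ℝ → ℝ → ℝ} {c : ℝ} {Z W : ℝ → ℝ⟦X⟧}
    (h : SolvesIntegralEq ψ a c Z W) {u : ℝ} (hu : u ∈ Set.Icc (0 : ℝ) 1) (n : ℕ) :
    PowerSeries.coeff (n + 1) (Z u) =
      ∫ v in (0 : ℝ)..1, a u v * PowerSeries.coeff n (PowerSeries.subst (W v) ψ : ℝ⟦X⟧) := by
  rw [(h u hu).2, map_add, PowerSeries.coeff_succ_X_mul, PowerSeries.coeff_mk]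
  simp

/-- The coefficients of `1/(1-W)` up to degree `n` depend only on those of `W`. -/
theorem coeff_subst_geom_congr {W W' : ℝ⟦X⟧} (hW : PowerSeries.constantCoeff W = 0)
    (hW' : PowerSeries.constantCoeff W' = 0) (n : ℕ)
    (h : ∀ k ≤ n, PowerSeries.coeff k W = PowerSeries.coeff k W') :
    PowerSeries.coeff n (PowerSeries.subst W ((1 - PowerSeries.X)⁻¹ : ℝ⟦X⟧) : ℝ⟦X⟧) =
      PowerSeries.coeff n (PowerSeries.subst W' ((1 - PowerSeries.X)⁻¹ : ℝ⟦X⟧) : ℝ⟦X⟧) := by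
  have e : ∀ W : ℝ⟦X⟧, PowerSeries.constantCoeff W = 0 →
      (PowerSeries.subst W ((1 - PowerSeries.X)⁻¹ : ℝ⟦X⟧) : ℝ⟦X⟧) =
        1 + W * PowerSeries.subst W ((1 - PowerSeries.X)⁻¹ : ℝ⟦X⟧) := by
    intro W hW
    have := subst_geom hW
    rw [mul_sub, mul_one, sub_eq_iff_eq_add] at this
    rw [mul_comm W]
    exact this
  induction n using Nat.strong_induction_on with
  | _ n ih =>
    rw [e W hW, e W' hW', map_add, map_add, PowerSeries.coeff_mul, PowerSeries.coeff_mul]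
    congr 1
    rcases n with _ | n
    · simp [hW, hW']
    · rw [Finset.Nat.sum_antidiagonal_succ, Finset.Nat.sum_antidiagonal_succ]
      congr 1
      · simp [hW, hW']
      · refine Finset.sum_congr rfl fun x hx => ?_
        have hx : x.1 + x.2 = n := by simpa using hx
        rw [h _ (by omega), ih x.2 (by omega) fun k hk => h k (by omega)]

/-- Induction on the degree, for both series and all u in [0,1] at once: the coefficient of degree n
+ 1 is an integral of coefficients of degree n of ψ(X_v) or ψ(Y_v), which involve no higher ones of
X_v or Y_v. -/
theorem solvesIntegralSystem_geom_unique {a b : ℝ → ℝ → ℝ} {X Y X' Y' : ℝ → ℝ⟦X⟧}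
    (h : SolvesIntegralSystem (1 - PowerSeries.X)⁻¹ a b 0 0 X Y)
    (h' : SolvesIntegralSystem (1 - PowerSeries.X)⁻¹ a b 0 0 X' Y') :
    ∀ u ∈ Set.Icc (0 : ℝ) 1, X u = X' u ∧ Y u = Y' u := by
  have key : ∀ n, ∀ u ∈ Set.Icc (0 : ℝ) 1,
      PowerSeries.coeff n (X u) = PowerSeries.coeff n (X' u) ∧
      PowerSeries.coeff n (Y u) = PowerSeries.coeff n (Y' u) := by
    intro n
    induction n using Nat.strong_induction_on with
    | _ n ih =>
      intro u hu
      rcases n with _ | n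
      · simp only [PowerSeries.coeff_zero_eq_constantCoeff_apply]
        rw [constantCoeff_of_solvesIntegralEq h.1 hu, constantCoeff_of_solvesIntegralEq h'.1 hu,
          constantCoeff_of_solvesIntegralEq h.2 hu, constantCoeff_of_solvesIntegralEq h'.2 hu]
        exact ⟨rfl, rfl⟩
      · rw [coeff_succ_of_solvesIntegralEq h.1 hu, coeff_succ_of_solvesIntegralEq h'.1 hu,
          coeff_succ_of_solvesIntegralEq h.2 hu, coeff_succ_of_solvesIntegralEq h'.2 hu]
        constructor <;> refine intervalIntegral.integral_congr fun v hv => ?_ <;>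
          rw [Set.uIcc_of_le zero_le_one] at hv <;> refine congrArg (HMul.hMul _) ?_
        · exact coeff_subst_geom_congr (constantCoeff_of_solvesIntegralEq h.2 hv)
            (constantCoeff_of_solvesIntegralEq h'.2 hv) n fun k hk => (ih k (by omega) v hv).2
        · exact coeff_subst_geom_congr (constantCoeff_of_solvesIntegralEq h.1 hv)
            (constantCoeff_of_solvesIntegralEq h'.1 hv) n fun k hk => (ih k (by omega) v hv).1
  exact fun u hu => ⟨PowerSeries.ext fun n => (key n u hu).1, PowerSeries.ext fun n => (key n u hu).2⟩

/-! ### The value at `0` -/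

theorem integral_kernelY_zero (g : ℝ → ℝ) :
    ∫ v in (0 : ℝ)..1, kernelY 0 v * g v = ∫ v in (0 : ℝ)..1, g v := by
  refine intervalIntegral.integral_congr fun v hv => ?_
  rw [Set.uIcc_of_le zero_le_one] at hv
  simp [kernelY, hv.1, hv.2]

/-- The reflection `v ↦ 1 - v` exchanges the kernels. -/
theorem kernelX_reflect (u v : ℝ) : kernelX (1 - u) (1 - v) = kernelY u v := by
  simp only [kernelX, kernelY, Set.indicator_apply, Set.mem_Icc, Pi.one_apply]
  congr 1
  grind

theorem kernelY_reflect (u v : ℝ) : kernelY (1 - u) (1 - v) = kernelX u v := by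
  rw [← kernelX_reflect, sub_sub_cancel, sub_sub_cancel]

theorem PlaneTree.phi_reflect (l : List PlaneTree) : ∀ {a b : ℝ → ℝ → ℝ},
    (∀ u v, a (1 - u) (1 - v) = b u v) → (∀ u v, b (1 - u) (1 - v) = a u v) →
    ∀ u, phi a b (node l) (1 - u) = phi b a (node l) u := by
  induction l using forest_induction with
  | nil => intro a b _ _ u; rw [phi_nil, phi_nil]
  | cons c r hc hr =>
    intro a b h h' u
    rw [phi_cons, phi_cons, hr h h']
    congr 1
    have := intervalIntegral.integral_comp_sub_left (a := 0) (b := 1)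
      (fun v => a (1 - u) v * phi b a (node c) v) 1
    rw [sub_self, sub_zero] at this
    rw [← this]
    simp only [h, hc h' h]

/-- The word (TT*)ⁿ starts with T and so produces φʸ, while Y_0 involves φˣ; the two agree only
after integration. -/
theorem integral_phiSum_reflect (n : ℕ) : ∫ v in (0 : ℝ)..1, phiSum kernelX kernelY n v =
    ∫ v in (0 : ℝ)..1, phiSum kernelY kernelX n v := by
  have := intervalIntegral.integral_comp_sub_left (a := 0) (b := 1)
    (phiSum kernelX kernelY n) 1
  rw [sub_self, sub_zero] at this
  rw [← this]
  simp only [phiSum, phi_reflect _ kernelX_reflect kernelY_reflect]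

/-! ### Noncrossing involutions of an interval -/

/-- `σ` restricts to a noncrossing involution of `{i, …, j - 1}` without fixed point and fixes the
other points. -/
structure IsNonCrossingOn {m : ℕ} (σ : Equiv.Perm (Fin m)) (i j : ℕ) : Prop where
  invol : ∀ q, σ (σ q) = q
  ne_iff : ∀ q, σ q ≠ q ↔ i ≤ q.val ∧ q.val < j
  nonCrossing : ∀ p q, p < q → q < σ p → ¬ σ p < σ q

namespace IsNonCrossingOn

variable {m : ℕ} {σ : Equiv.Perm (Fin m)} {i j : ℕ}

theorem fix (h : IsNonCrossingOn σ i j) {q : Fin m} (hq : q.val < i ∨ j ≤ q.val) : σ q = q := by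
  by_contra hne
  have := (h.ne_iff q).1 hne
  omega

theorem mapsTo (h : IsNonCrossingOn σ i j) {q : Fin m} (h1 : i ≤ q.val) (h2 : q.val < j) :
    i ≤ (σ q).val ∧ (σ q).val < j :=
  (h.ne_iff (σ q)).1 fun e => (h.ne_iff q).2 ⟨h1, h2⟩ (by rw [h.invol] at e; exact e.symm)

theorem apply_first (h : IsNonCrossingOn σ i j) (hi : i < m) (hij : i < j) :
    i < (σ ⟨i, hi⟩).val ∧ (σ ⟨i, hi⟩).val < j := by
  have h1 := h.mapsTo (q := ⟨i, hi⟩) le_rfl hij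
  have h2 := (h.ne_iff ⟨i, hi⟩).2 ⟨le_rfl, hij⟩
  have h3 : (σ ⟨i, hi⟩).val ≠ i := fun e => h2 (Fin.ext e)
  omega

/-- The involution that exchanges `i` and `k` and is given by `σ` and `τ` in between and
afterwards. -/
def glue (i k : Fin m) (σ τ : Equiv.Perm (Fin m)) : Equiv.Perm (Fin m) := Equiv.swap i k * σ * τ

variable {τ : Equiv.Perm (Fin m)} {k : Fin m} {a : Fin m}

/-- The three factors of `glue` move disjoint sets of points: the pair {a, k}, the points between,
and the points after k. -/
theorem glue_apply (hσ : IsNonCrossingOn σ (a.val + 1) k) (hτ : IsNonCrossingOn τ (k.val + 1) j)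
    (hak : a < k) (x : Fin m) :
    glue a k σ τ x = if x = a then k else if x = k then a else if x < k then σ x else τ x := by
  have hak' : a.val < k.val := hak
  have sw : ∀ y : Fin m, y.val ≠ a.val → y.val ≠ k.val → Equiv.swap a k y = y := fun y h1 h2 =>
    Equiv.swap_apply_of_ne_of_ne (fun h => h1 (by rw [h])) (fun h => h2 (by rw [h]))
  simp only [glue, Equiv.Perm.mul_apply]
  split_ifs with h1 h2 h3
  · subst h1
    rw [hτ.fix (by omega), hσ.fix (by omega), Equiv.swap_apply_left]
  · subst h2
    rw [hτ.fix (by omega), hσ.fix (by omega), Equiv.swap_apply_right]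
  · have h3 : x.val < k.val := h3
    have h1 : x.val ≠ a.val := fun h => h1 (Fin.ext h)
    rw [hτ.fix (by omega)]
    rcases Nat.lt_or_ge x.val a.val with h | h
    · rw [hσ.fix (by omega), sw x (by omega) (by omega)]
    · have := hσ.mapsTo (q := x) (by omega) (by omega)
      exact sw _ (by omega) (by omega)
  · have h2 : x.val ≠ k.val := fun h => h2 (Fin.ext h)
    have h3 : ¬ x.val < k.val := h3
    have : k.val < (τ x).val := by
      rcases Nat.lt_or_ge x.val j with h | h
      · have := hτ.mapsTo (q := x) (by omega) (by omega)
        omega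
      · rw [hτ.fix (by omega)]; omega
    rw [hσ.fix (by omega), sw _ (by omega) (by omega)]

theorem glue_isNonCrossingOn (hσ : IsNonCrossingOn σ (a.val + 1) k)
    (hτ : IsNonCrossingOn τ (k.val + 1) j) (hak : a < k) (hkj : k.val < j) :
    IsNonCrossingOn (glue a k σ τ) a j := by
  have g := glue_apply hσ hτ hak
  have e : ∀ x y : Fin m, x = y ↔ x.val = y.val := fun x y => Fin.ext_iff
  have l : ∀ x y : Fin m, x < y ↔ x.val < y.val := fun x y => Iff.rfl
  have hs : ∀ x : Fin m, a.val + 1 ≤ x.val ∧ x.val < k.val ∧ a.val + 1 ≤ (σ x).val ∧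
      (σ x).val < k.val ∧ (σ x).val ≠ x.val ∨
      (x.val ≤ a.val ∨ k.val ≤ x.val) ∧ (σ x).val = x.val := by
    intro x
    by_cases h : a.val + 1 ≤ x.val ∧ x.val < k.val
    · have h1 := hσ.mapsTo h.1 h.2
      have h2 := (hσ.ne_iff x).2 h
      exact .inl ⟨h.1, h.2, h1.1, h1.2, fun h => h2 (Fin.ext h)⟩
    · exact .inr ⟨by omega, congrArg _ (hσ.fix (by omega))⟩
  have ht : ∀ x : Fin m, k.val + 1 ≤ x.val ∧ x.val < j ∧ k.val + 1 ≤ (τ x).val ∧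
      (τ x).val < j ∧ (τ x).val ≠ x.val ∨
      (x.val ≤ k.val ∨ j ≤ x.val) ∧ (τ x).val = x.val := by
    intro x
    by_cases h : k.val + 1 ≤ x.val ∧ x.val < j
    · have h1 := hτ.mapsTo h.1 h.2
      have h2 := (hτ.ne_iff x).2 h
      exact .inl ⟨h.1, h.2, h1.1, h1.2, fun h => h2 (Fin.ext h)⟩
    · exact .inr ⟨by omega, congrArg _ (hτ.fix (by omega))⟩
  have hak' : a.val < k.val := hak
  refine ⟨fun x => ?_, fun x => ?_, fun p q hpq hqp => ?_⟩
  · have h1 := hs x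
    have h2 := ht x
    have h3 := hσ.invol x
    have h4 := hτ.invol x
    rw [g x]
    split_ifs with c1 c2 c3
    · rw [g, if_neg hak.ne', if_pos rfl, c1]
    · rw [g, if_pos rfl, c2]
    · simp only [e, l] at c1 c2 c3
      rw [g, if_neg (by rw [e]; omega), if_neg (by rw [e]; omega), if_pos (by rw [l]; omega), h3]
    · simp only [e, l] at c1 c2 c3
      rw [g, if_neg (by rw [e]; omega), if_neg (by rw [e]; omega), if_neg (by rw [l]; omega), h4]
  · have h1 := hs x
    have h2 := ht x
    rw [g x]
    split_ifs with c1 c2 c3 <;> simp only [e, l, ne_eq] at * <;> omega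
  · have h1 := hs p
    have h2 := ht p
    have h1' := hs q
    have h2' := ht q
    have h3 := hσ.nonCrossing p q hpq
    have h4 := hτ.nonCrossing p q hpq
    rw [g p] at hqp ⊢
    rw [g q]
    simp only [l, e] at hpq hqp h3 h4 ⊢
    split_ifs at hqp ⊢ <;> omega

/-- The restriction of a noncrossing involution to an invariant interval. -/
theorem exists_restrict (h : IsNonCrossingOn σ i j) {b c : ℕ} (hib : i ≤ b) (hcj : c ≤ j)
    (hc : IntervalClosed σ b c) :
    ∃ ρ : Equiv.Perm (Fin m), IsNonCrossingOn ρ b c ∧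
      ∀ q : Fin m, b ≤ q.val → q.val < c → ρ q = σ q := by
  let f : Fin m → Fin m := fun q => if b ≤ q.val ∧ q.val < c then σ q else q
  have f1 : ∀ q, b ≤ q.val ∧ q.val < c → f q = σ q := fun q hq => if_pos hq
  have f2 : ∀ q, ¬ (b ≤ q.val ∧ q.val < c) → f q = q := fun q hq => if_neg hq
  have hf : Function.Involutive f := by
    intro q
    by_cases hq : b ≤ q.val ∧ q.val < c
    · rw [f1 q hq, f1 _ (hc q hq.1 hq.2), h.invol]
    · rw [f2 q hq, f2 q hq]
  refine ⟨hf.toPerm f, ⟨hf, fun q => ?_, fun p q hpq hqp => ?_⟩, fun q h1 h2 => f1 q ⟨h1, h2⟩⟩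
  · change f q ≠ q ↔ _
    by_cases hq : b ≤ q.val ∧ q.val < c
    · rw [f1 q hq, h.ne_iff]
      constructor <;> intro <;> omega
    · rw [f2 q hq]; simp only [ne_eq, not_true_eq_false, hq]
  · change q < f p at hqp
    change ¬ f p < f q
    by_cases hp : b ≤ p.val ∧ p.val < c
    · rw [f1 p hp] at hqp ⊢
      have h1 := hc p hp.1 hp.2
      have h2 : p.val < q.val := hpq
      have h3 : q.val < (σ p).val := hqp
      rw [f1 q (by omega)]
      exact h.nonCrossing p q hpq hqp
    · rw [f2 p hp] at hqp
      exact absurd hqp hpq.asymm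

/-- A pair with one point between a and σ a and the other beyond σ a would cross the pair (a, σ a).
-/
theorem split (h : IsNonCrossingOn σ a j) (haj : a.val < j) :
    IntervalClosed σ (a + 1) (σ a) ∧ IntervalClosed σ (σ a + 1) j := by
  have h0 : a.val < (σ a).val ∧ (σ a).val < j := h.apply_first a.isLt haj
  refine ⟨fun q h1 h2 => ?_, fun q h1 h2 => ?_⟩
  · have n1 := h.nonCrossing a q (Fin.lt_def.2 (by omega)) (Fin.lt_def.2 h2)
    have n2 := h.mapsTo (q := q) (by omega) (by omega)
    have n3 : (σ q).val ≠ (σ a).val := fun e => by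
      have := σ.injective (Fin.ext e); rw [this] at h1; omega
    have n4 : (σ q).val ≠ a.val := fun e => by
      have := h.invol q; rw [Fin.ext e] at this; rw [this] at h2; omega
    rw [Fin.lt_def] at n1
    omega
  · have n2 := h.mapsTo (q := q) (by omega) (by omega)
    refine ⟨?_, n2.2⟩
    by_contra hcon
    have n3 : (σ q).val ≠ (σ a).val := fun e => by
      have := σ.injective (Fin.ext e); rw [this] at h1; omega
    have n4 : (σ q).val ≠ a.val := fun e => by
      have := h.invol q; rw [Fin.ext e] at this; rw [this] at h1; omega
    have n1 := h.nonCrossing a (σ q) (Fin.lt_def.2 (by omega)) (Fin.lt_def.2 (by omega))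
    rw [h.invol, Fin.lt_def] at n1
    omega

end IsNonCrossingOn

open IsNonCrossingOn

/-- The noncrossing involutions of the interval `{i, …, j - 1}`. -/
noncomputable def nonCrossingOn (m i j : ℕ) : Finset (Equiv.Perm (Fin m)) := by
  classical
  exact {σ | IsNonCrossingOn σ i j}

@[simp] theorem mem_nonCrossingOn {m i j : ℕ} {σ : Equiv.Perm (Fin m)} :
    σ ∈ nonCrossingOn m i j ↔ IsNonCrossingOn σ i j := by
  simp [nonCrossingOn]

theorem nonCrossingOn_full (m : ℕ) : nonCrossingOn m 0 m = nonCrossingInvolutions m := by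
  ext σ
  rw [mem_nonCrossingOn, mem_nonCrossing]
  constructor
  · rintro ⟨h1, h2, h3⟩
    exact ⟨h1, fun i => (h2 i).2 ⟨Nat.zero_le _, i.isLt⟩, fun ⟨p, q, a, b, c⟩ => h3 p q a b c⟩
  · rintro ⟨h1, h2, h3⟩
    exact ⟨h1, fun q => ⟨fun _ => ⟨Nat.zero_le _, q.isLt⟩, fun _ => h2 q⟩,
      fun p q a b c => h3 ⟨p, q, a, b, c⟩⟩

theorem nonCrossingOn_self (m i : ℕ) : nonCrossingOn m i i = {1} := by
  ext σ
  rw [mem_nonCrossingOn, Finset.mem_singleton]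
  constructor
  · exact fun h => Equiv.ext fun q => h.fix (by omega)
  · rintro rfl
    exact ⟨fun _ => rfl, fun q => by simp, fun p q h h' => absurd h' h.asymm⟩

/-- Noncrossing involutions split at the partner of the first point. -/
theorem sum_nonCrossingOn {M : Type*} [AddCommMonoid M] {m : ℕ} (a : Fin m) {j : ℕ}
    (haj : a.val < j) (f : Equiv.Perm (Fin m) → M) :
    ∑ σ ∈ nonCrossingOn m a j, f σ = ∑ k : Fin m with a.val < k.val ∧ k.val < j,
      ∑ z ∈ nonCrossingOn m (a + 1) k ×ˢ nonCrossingOn m (k + 1) j, f (glue a k z.1 z.2) := by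
  rw [Finset.sum_sigma']
  symm
  refine Finset.sum_bij (fun z _ => glue a z.1 z.2.1 z.2.2) (fun z hz => ?_)
    (fun z hz z' hz' h => ?_) (fun σ hσ => ?_) (fun _ _ => rfl)
  · obtain ⟨k, σ, τ⟩ := z
    simp only [Finset.mem_sigma, Finset.mem_filter, Finset.mem_univ, true_and, Finset.mem_product,
      mem_nonCrossingOn] at hz ⊢
    exact glue_isNonCrossingOn hz.2.1 hz.2.2 (Fin.lt_def.2 hz.1.1) hz.1.2
  · obtain ⟨k, σ, τ⟩ := z
    obtain ⟨k', σ', τ'⟩ := z'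
    simp only [Finset.mem_sigma, Finset.mem_filter, Finset.mem_univ, true_and, Finset.mem_product,
      mem_nonCrossingOn] at hz hz' h
    obtain ⟨⟨c1, c2⟩, hσ, hτ⟩ := hz
    obtain ⟨⟨c1', c2'⟩, hσ', hτ'⟩ := hz'
    have g := glue_apply hσ hτ (Fin.lt_def.2 c1)
    have g' := glue_apply hσ' hτ' (Fin.lt_def.2 c1')
    have hk : k = k' := by
      have h1 := g a
      have h2 := g' a
      rw [if_pos rfl] at h1 h2
      rw [← h1, ← h2, h]
    subst hk
    have e1 : σ = σ' := by
      refine Equiv.ext fun x => ?_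
      by_cases hx : a.val + 1 ≤ x.val ∧ x.val < k.val
      · have h1 := g x
        have h2 := g' x
        rw [if_neg (by rw [Fin.ext_iff]; omega), if_neg (by rw [Fin.ext_iff]; omega),
          if_pos (Fin.lt_def.2 hx.2)] at h1 h2
        rw [← h1, ← h2, h]
      · rw [hσ.fix (by omega), hσ'.fix (by omega)]
    have e2 : τ = τ' := by
      refine Equiv.ext fun x => ?_
      by_cases hx : k.val + 1 ≤ x.val ∧ x.val < j
      · have h1 := g x
        have h2 := g' x
        rw [if_neg (by rw [Fin.ext_iff]; omega), if_neg (by rw [Fin.ext_iff]; omega),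
          if_neg (by rw [Fin.lt_def]; omega)] at h1 h2
        rw [← h1, ← h2, h]
      · rw [hτ.fix (by omega), hτ'.fix (by omega)]
    rw [e1, e2]
  · rw [mem_nonCrossingOn] at hσ
    obtain ⟨c1, c2⟩ : a.val < (σ a).val ∧ (σ a).val < j := hσ.apply_first a.isLt haj
    obtain ⟨s1, s2⟩ := hσ.split haj
    obtain ⟨ρ, hρ, hρ'⟩ := hσ.exists_restrict (by omega) c2.le s1
    obtain ⟨τ, hτ, hτ'⟩ := hσ.exists_restrict (by omega) le_rfl s2
    refine ⟨⟨σ a, ρ, τ⟩, ?_, ?_⟩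
    · simp only [Finset.mem_sigma, Finset.mem_filter, Finset.mem_univ, true_and,
        Finset.mem_product, mem_nonCrossingOn]
      exact ⟨⟨c1, c2⟩, hρ, hτ⟩
    · refine Equiv.ext fun x => ?_
      dsimp only
      rw [glue_apply hρ hτ (Fin.lt_def.2 c1)]
      split_ifs with h1 h2 h3
      · rw [h1]
      · rw [h2, hσ.invol]
      · have h3 := Fin.lt_def.1 h3
        rw [Fin.ext_iff] at h1
        by_cases hx : a.val + 1 ≤ x.val
        · exact hρ' x hx h3
        · rw [hσ.fix (by omega), hρ.fix (by omega)]
      · rw [Fin.lt_def] at h3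
        rw [Fin.ext_iff] at h2
        by_cases hx : x.val < j
        · exact hτ' x (by omega) hx
        · rw [hσ.fix (by omega), hτ.fix (by omega)]

/-! ### The moments of a generalized circular element -/

set_option linter.unusedSectionVars false

section Moments

variable {B A : Type*} [Ring B] [StarRing B] [Algebra ℂ B] [StarModule ℂ B]
  [Ring A] [StarRing A] [Algebra ℂ A] [StarModule ℂ A]

theorem evalSubword_congr_perm (ι : B →⋆ₐ[ℂ] A) (κ : A →ₗ[ℂ] A →ₗ[ℂ] B) {m : ℕ}
    (σ σ' : Equiv.Perm (Fin m)) (a : Fin m → A) (i j : ℕ)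
    (h : ∀ q : Fin m, i ≤ q.val → q.val < j → σ q = σ' q) :
    evalSubword ι κ σ a i j = evalSubword ι κ σ' a i j := by
  induction hn : j - i using Nat.strong_induction_on generalizing i j with
  | _ n ih =>
    subst hn
    unfold evalSubword
    by_cases hij : i < j
    · split_ifs with hi
      · dsimp only
        rw [h ⟨i, hi⟩ le_rfl hij]
        split_ifs with hk
        · rw [ih _ (by omega) _ _ (fun q hq hq' => h q (by omega) (by omega)) rfl,
            ih _ (by omega) _ _ (fun q hq hq' => h q (by omega) (by omega)) rfl]
        · rfl
      · rfl
    · split_ifs with hi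
      · dsimp only
        rw [if_neg (by omega), if_neg (by omega)]
      · rfl

/-- The sum of the evaluations of the subword `u_i ⋯ u_{j-1}` over the noncrossing involutions. -/
noncomputable def subwordSum (ι : B →⋆ₐ[ℂ] A) (κ : A →ₗ[ℂ] A →ₗ[ℂ] B) (m : ℕ) (u : ℕ → A)
    (i j : ℕ) : B :=
  ∑ σ ∈ nonCrossingOn m i j, evalSubword ι κ σ (fun q => u q.val) i j

theorem subwordSum_self (ι : B →⋆ₐ[ℂ] A) (κ : A →ₗ[ℂ] A →ₗ[ℂ] B) (m : ℕ) (u : ℕ → A) (i : ℕ) :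
    subwordSum ι κ m u i i = 1 := by
  rw [subwordSum, nonCrossingOn_self, Finset.sum_singleton]
  unfold evalSubword
  split_ifs with h
  · dsimp only
    rw [if_neg (by omega)]
  · rfl

/-- Once the partner k of i is fixed, the inner and the outer involutions are independent and
`evalSubword` factors accordingly. -/
theorem subwordSum_eq (ι : B →⋆ₐ[ℂ] A) (κ : A →ₗ[ℂ] A →ₗ[ℂ] B) {m : ℕ} (u : ℕ → A) {i j : ℕ}
    (hij : i < j) (hj : j ≤ m) : subwordSum ι κ m u i j = ∑ k ∈ Finset.Ioo i j,
      κ (u i * ι (subwordSum ι κ m u (i + 1) k)) (u k) * subwordSum ι κ m u (k + 1) j := by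
  have hi : i < m := by omega
  have h1 : ∑ k ∈ Finset.Ioo i j,
      κ (u i * ι (subwordSum ι κ m u (i + 1) k)) (u k) * subwordSum ι κ m u (k + 1) j =
      ∑ k : Fin m with i < k.val ∧ k.val < j,
      κ (u i * ι (subwordSum ι κ m u (i + 1) k)) (u k) * subwordSum ι κ m u (k + 1) j := by
    symm
    refine Finset.sum_bij (fun k _ => k.val) (fun k hk => by simpa using hk)
      (fun _ _ _ _ h => Fin.ext h) (fun k hk => ?_) fun _ _ => rfl
    rw [Finset.mem_Ioo] at hk
    exact ⟨⟨k, by omega⟩, by simpa using hk, rfl⟩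
  rw [h1, subwordSum, sum_nonCrossingOn ⟨i, hi⟩ hij]
  refine Finset.sum_congr rfl fun k hk => ?_
  simp only [Finset.mem_filter, Finset.mem_univ, true_and] at hk
  have hs : κ (u i * ι (subwordSum ι κ m u (i + 1) k)) (u k) =
      ∑ σ ∈ nonCrossingOn m (i + 1) k,
        κ (u i * ι (evalSubword ι κ σ (fun q => u q.val) (i + 1) k)) (u k) := by
    -- Linearity of ι and κ moves the sum over the inner involutions out of κ.
    rw [subwordSum, map_sum, Finset.mul_sum, map_sum, LinearMap.sum_apply]
  rw [hs, subwordSum, Finset.sum_mul_sum, ← Finset.sum_product']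
  refine Finset.sum_congr rfl fun z hz => ?_
  rw [Finset.mem_product, mem_nonCrossingOn, mem_nonCrossingOn] at hz
  have g := glue_apply (a := ⟨i, hi⟩) hz.1 hz.2 (Fin.lt_def.2 hk.1)
  have gi := g ⟨i, hi⟩
  rw [if_pos rfl] at gi
  have st := evalSubword_step ι κ (glue ⟨i, hi⟩ k z.1 z.2) (fun q => u q.val) ⟨i, hi⟩ j
    (by rw [gi]; exact Fin.lt_def.2 hk.1) (by rw [gi]; exact hk.2)
  rw [gi] at st
  refine st.trans ?_
  dsimp only
  rw [evalSubword_congr_perm ι κ _ z.1 _ (i + 1) k fun q h1 h2 => ?_,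
    evalSubword_congr_perm ι κ _ z.2 _ (k + 1) j fun q h1 h2 => ?_]
  · rw [g, if_neg (by rw [Fin.ext_iff]; simp; omega), if_neg (by rw [Fin.ext_iff]; omega),
      if_neg (by rw [Fin.lt_def]; omega)]
  · rw [g, if_neg (by rw [Fin.ext_iff]; simp; omega), if_neg (by rw [Fin.ext_iff]; omega),
      if_pos (by rw [Fin.lt_def]; omega)]

theorem subwordSum_odd (ι : B →⋆ₐ[ℂ] A) (κ : A →ₗ[ℂ] A →ₗ[ℂ] B) {m : ℕ} (u : ℕ → A) (i n : ℕ)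
    (h : i + (2 * n + 1) ≤ m) : subwordSum ι κ m u i (i + (2 * n + 1)) = 0 := by
  induction n using Nat.strong_induction_on generalizing i with
  | _ n ih =>
    rw [subwordSum_eq ι κ u (by omega) h]
    refine Finset.sum_eq_zero fun k hk => ?_
    rw [Finset.mem_Ioo] at hk
    obtain ⟨d, rfl⟩ : ∃ d, k = i + 1 + d := ⟨k - i - 1, by omega⟩
    -- The inner and the remaining word have 2n - 1 letters in all, so one of them is odd and
    -- evaluates to 0.
    rcases Nat.even_or_odd' d with ⟨c, rfl | rfl⟩
    · have := ih (n - c - 1) (by omega) (i + 1 + 2 * c + 1) (by omega)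
      rw [show i + 1 + 2 * c + 1 + (2 * (n - c - 1) + 1) = i + (2 * n + 1) by omega] at this
      rw [this, mul_zero]
    · rw [ih c (by omega) (i + 1) (by omega)]
      simp

/-- Only partners at odd distance survive, since otherwise an odd word is enclosed. In an
alternating word T is thus always paired with T*. -/
theorem subwordSum_even (ι : B →⋆ₐ[ℂ] A) (κ : A →ₗ[ℂ] A →ₗ[ℂ] B) {m : ℕ} (u : ℕ → A) (i n : ℕ)
    (h : i + 2 * (n + 1) ≤ m) : subwordSum ι κ m u i (i + 2 * (n + 1)) =
      ∑ x ∈ Finset.HasAntidiagonal.antidiagonal n,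
        κ (u i * ι (subwordSum ι κ m u (i + 1) (i + 1 + 2 * x.1))) (u (i + 1 + 2 * x.1)) *
          subwordSum ι κ m u (i + 2 + 2 * x.1) (i + 2 + 2 * x.1 + 2 * x.2) := by
  rw [subwordSum_eq ι κ u (by omega) h]
  symm
  refine Finset.sum_of_injOn (fun x => i + 1 + 2 * x.1) (fun x hx y hy hxy => ?_)
    (fun x hx => ?_) (fun k hk hk' => ?_) (fun x hx => ?_)
  · simp only [Finset.mem_coe, Finset.HasAntidiagonal.mem_antidiagonal] at hx hy hxy
    ext <;> omega
  · simp only [Finset.mem_coe, Finset.HasAntidiagonal.mem_antidiagonal, Finset.mem_Ioo] at hx ⊢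
    omega
  · rw [Finset.mem_Ioo] at hk
    obtain ⟨d, rfl⟩ : ∃ d, k = i + 1 + d := ⟨k - i - 1, by omega⟩
    rcases Nat.even_or_odd' d with ⟨c, rfl | rfl⟩
    · exact absurd ⟨(c, n - c), by simp; omega, rfl⟩ hk'
    · rw [subwordSum_odd ι κ u _ _ (by omega)]
      simp
  · simp only [Finset.HasAntidiagonal.mem_antidiagonal] at hx
    rw [show i + 2 * (n + 1) = i + 2 + 2 * x.1 + 2 * x.2 by omega,
      show i + 1 + 2 * x.1 + 1 = i + 2 + 2 * x.1 by omega]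

end Moments

/-! ### The moments of the triangular operator -/

section Triangular

open PlaneTree

variable {A : Type*} [Ring A] [StarRing A] [Algebra ℂ A] [StarModule ℂ A]

/-- The alternating word `T T* T T* ⋯`. -/
def alternating (T : A) (q : ℕ) : A := starPower T (decide (q % 2 = 1))

theorem prod_alternating (T : A) (n : ℕ) :
    (List.ofFn fun i : Fin (2 * n) => alternating T i.val).prod = (T * star T) ^ n := by
  induction n with
  | zero => simp
  | succ n ih =>
    have h : ∀ q, alternating T (q + 2) = alternating T q := fun q => by simp [alternating]
    rw [show 2 * (n + 1) = 2 * n + 1 + 1 by ring, List.ofFn_succ, List.ofFn_succ, List.prod_cons,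
      List.prod_cons, pow_succ', ← ih, mul_assoc]
    simp only [Fin.val_succ, h]
    simp [alternating, starPower]

/-- The recursions `subwordSum_even` and `phiSum_succ` coincide: the parity of i tells the first
letter, hence the kernel, and the inner word starts at i + 1, with the opposite parity. -/
theorem eval_subwordSum_alternating {S : OpValuedProbSpace ℂ[X] A} {T : A}
    {κ : A →ₗ[ℂ] A →ₗ[ℂ] ℂ[X]} (hκ : IsBimoduleProduct S.incl κ)
    (h1 : ∀ b : ℂ[X], ∀ x ∈ Set.Icc (0 : ℝ) 1,
      (κ T (S.incl b * star T)).eval (x : ℂ) = ∫ s in x..1, b.eval (s : ℂ))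
    (h2 : ∀ b : ℂ[X], ∀ x ∈ Set.Icc (0 : ℝ) 1,
      (κ (star T) (S.incl b * T)).eval (x : ℂ) = ∫ s in (0 : ℝ)..x, b.eval (s : ℂ))
    {m : ℕ} (n i : ℕ) (hm : i + 2 * n ≤ m) :
    ∀ x ∈ Set.Icc (0 : ℝ) 1,
      (subwordSum S.incl κ m (alternating T) i (i + 2 * n)).eval (x : ℂ) =
        ((if i % 2 = 0 then phiSum kernelY kernelX n x else phiSum kernelX kernelY n x : ℝ) : ℂ) := by
  induction n using Nat.strong_induction_on generalizing i with
  | _ n ih =>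
    intro x hx
    rcases n with _ | n
    · simp [subwordSum_self, phiSum_zero]
    rw [subwordSum_even _ _ _ _ _ hm, Polynomial.eval_finsetSum]
    have cX := isContinuousKernel_kernelX
    have cY := isContinuousKernel_kernelY
    split_ifs with hi
    · rw [phiSum_succ cY cX, Complex.ofReal_sum]
      refine Finset.sum_congr rfl fun z hz => ?_
      rw [Finset.HasAntidiagonal.mem_antidiagonal] at hz
      have e1 : alternating T i = T := by simp [alternating, starPower, hi]
      have e2 : alternating T (i + 1 + 2 * z.1) = star T := by
        have : (i + 1 + 2 * z.1) % 2 = 1 := by omega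
        simp [alternating, starPower, this]
      rw [Polynomial.eval_mul, e1, e2, hκ.middle, h1 _ x hx,
        ih z.2 (by omega) _ (by omega) x hx, if_pos (by omega), Complex.ofReal_mul,
        integral_kernelY hx (continuous_phiSum cX cY _), ← intervalIntegral.integral_ofReal]
      congr 1
      refine intervalIntegral.integral_congr fun s hs => ?_
      rw [Set.uIcc_of_le hx.2] at hs
      rw [ih z.1 (by omega) _ (by omega) s ⟨hx.1.trans hs.1, hs.2⟩, if_neg (by omega)]
    · rw [phiSum_succ cX cY, Complex.ofReal_sum]
      refine Finset.sum_congr rfl fun z hz => ?_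
      rw [Finset.HasAntidiagonal.mem_antidiagonal] at hz
      have e1 : alternating T i = star T := by
        have : i % 2 = 1 := by omega
        simp [alternating, starPower, this]
      have e2 : alternating T (i + 1 + 2 * z.1) = T := by
        have : (i + 1 + 2 * z.1) % 2 = 0 := by omega
        simp [alternating, starPower, this]
      rw [Polynomial.eval_mul, e1, e2, hκ.middle, h2 _ x hx,
        ih z.2 (by omega) _ (by omega) x hx, if_neg (by omega), Complex.ofReal_mul,
        integral_kernelX hx, ← intervalIntegral.integral_ofReal]
      congr 1
      refine intervalIntegral.integral_congr fun s hs => ?_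
      rw [Set.uIcc_of_le hx.1] at hs
      rw [ih z.1 (by omega) _ (by omega) s ⟨hs.1, hs.2.trans hx.2⟩, if_pos (by omega)]

theorem trace_triangular {S : OpValuedProbSpace ℂ[X] A} {T : A} (h : IsTriangularOperator S T)
    (n : ℕ) : trace S ((T * star T) ^ n) =
      ((∫ v in (0 : ℝ)..1, phiSum kernelX kernelY n v : ℝ) : ℂ) := by
  obtain ⟨κ, ⟨hκ, he, -⟩, h1, h2, -, -⟩ := h
  have hE : S.E ((T * star T) ^ n) = subwordSum S.incl κ (2 * n) (alternating T) 0 (2 * n) := by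
    -- With all coefficients equal to 1 and stars at the odd positions, the moment formula is the
    -- one for (TT*)ⁿ.
    have := he n (fun _ => 1) fun i => decide (i.val % 2 = 1)
    simp only [map_one, one_mul] at this
    rw [← prod_alternating, subwordSum, nonCrossingOn_full]
    exact this
  rw [integral_phiSum_reflect, trace, hE, ← intervalIntegral.integral_ofReal]
  refine intervalIntegral.integral_congr fun s hs => ?_
  rw [Set.uIcc_of_le zero_le_one] at hs
  have := eval_subwordSum_alternating hκ h1 h2 (m := 2 * n) n 0 (by omega) s hs
  rw [zero_add, if_pos rfl] at this
  exact this

end Triangular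

/-! ### The integral system and the moments -/

theorem corollary1 :
    -- the P-series `X`, `Y` solve the integral system with `X₀ = Y₁ = 0` and `ψ(z) = 1/(1-z)`
    SolvesIntegralSystem (1 - PowerSeries.X)⁻¹ kernelX kernelY 0 0
      (pSeries (1 - PowerSeries.X)⁻¹ kernelX kernelY 0)
      (pSeries (1 - PowerSeries.X)⁻¹ kernelY kernelX 0) ∧
    -- and they are its only solution, for parameters in `[0,1]`
    (∀ X Y : ℝ → ℝ⟦X⟧,
      SolvesIntegralSystem (1 - PowerSeries.X)⁻¹ kernelX kernelY 0 0 X Y →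
      ∀ u ∈ Set.Icc (0 : ℝ) 1,
        X u = pSeries (1 - PowerSeries.X)⁻¹ kernelX kernelY 0 u ∧
        Y u = pSeries (1 - PowerSeries.X)⁻¹ kernelY kernelX 0 u) ∧
    -- `Y_0` as a sum over rooted trees
    pSeries (1 - PowerSeries.X)⁻¹ kernelY kernelX 0 0 =
      RTree.series (1 - PowerSeries.X)⁻¹
        (fun t => ∫ v in (0 : ℝ)..1, RTree.phi kernelX kernelY t v) ∧
    -- `Y_0` as a sum over rooted plane trees
    pSeries (1 - PowerSeries.X)⁻¹ kernelY kernelX 0 0 =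
      PowerSeries.mk (fun n => ∑ t ∈ PlaneTree.ofOrder n,
        ∫ v in (0 : ℝ)..1, PlaneTree.phi kernelX kernelY t v) ∧
    -- `Y_0` as the generating function of the moments of `T T*`: `∑_{n ≥ 1} s^n τ((T T*)^(n-1))`
    (∀ {A : Type*} [Ring A] [StarRing A] [Algebra ℂ A] [StarModule ℂ A]
      (S : OpValuedProbSpace ℂ[X] A) (T : A), IsTriangularOperator S T →
      PowerSeries.map Complex.ofRealHom (pSeries (1 - PowerSeries.X)⁻¹ kernelY kernelX 0 0) =
        PowerSeries.X * PowerSeries.mk fun n : ℕ => trace S ((T * star T) ^ n)) := by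
  have cX := isContinuousKernel_kernelX
  have cY := isContinuousKernel_kernelY
  have hsol : SolvesIntegralSystem (1 - PowerSeries.X)⁻¹ kernelX kernelY 0 0
      (pSeries (1 - PowerSeries.X)⁻¹ kernelX kernelY 0)
      (pSeries (1 - PowerSeries.X)⁻¹ kernelY kernelX 0) :=
    ⟨solvesIntegralEq_pSeries_geom cX cY, solvesIntegralEq_pSeries_geom cY cX⟩
  refine ⟨hsol, fun X Y h => solvesIntegralSystem_geom_unique h hsol, ?_, ?_, ?_⟩
  · rw [pSeries, map_zero, zero_add]
    simp only [integral_kernelY_zero]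
  · rw [pSeries_geom]
    simp only [integral_kernelY_zero]
  · intro A _ _ _ _ S T hT
    ext n
    rw [PowerSeries.coeff_map]
    rcases n with _ | n
    · simp [constantCoeff_pSeries_geom]
    · rw [coeff_succ_pSeries_geom cY cX, PowerSeries.coeff_succ_X_mul, PowerSeries.coeff_mk,
        trace_triangular hT, integral_kernelY_zero]
      rfl
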